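/- **Conventions.** All Hilbert spaces are complex; $\mathbf B(\mathcal H,\mathcal K)$ denotes the bounded linear operators and $\mathbf B(\mathcal H)=\mathbf B(\mathcal H,\mathcal H)$; $\mathcal R(A)$ is the range of $A$ and $|A|=(A^*A)^{1/2}$; $\dim$ is the Hilbert space (orthogonal) dimension; inclusions of Hilbert spaces $\mathcal H\subseteq\mathcal K$ are isometric embeddings. For $A\in\mathbf B(\mathcal H)$ and $B\in\mathbf B(\mathcal K)$ with $\mathcal H\subseteq\mathcal K$, $A\subseteq B$ means $Ah=Bh$ for all $h\in\mathcal H$. $S$ is *subnormal* if $S\subseteq N$ for some normal $N$ (a *normal extension*); a normal extension $N\in\mathbf B(\mathcal K)$ of $S\in\mathbf B(\mathcal H)$ is *minimal*, $N=\mathrm{mne}\,S$, if $\mathcal K$ is the only closed subspace of $\mathcal K$ that contains $\mathcal H$ and reduces $N$. $\{\cdot\}'$ denotes the commutant. If $N=\mathrm{mne}\,S$ and $A\in\{S,S^*\}'$, the *lift of $A$ relative to $\{N\}'$* is the unique $B\in\{N\}'\cap\{P\}'$ with $A\subseteq B$, where $P\in\mathbf B(\mathcal K)$ is the orthogonal projection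 onto $\mathcal H$. An operator $\begin{bmatrix}V&E\\0&X\end{bmatrix}\in\mathbf B(\mathcal H_1\oplus\mathcal H_2)$ with $\mathcal H_1,\mathcal H_2\neq\{0\}$ is *of class $\mathscr S_{\mathcal H_1,\mathcal H_2}$* (resp. *$\mathscr N_{\mathcal H_1,\mathcal H_2}$*) if $V^*V=I$, $V^*E=0$, $XE^*E=E^*EX$ and $X$ is subnormal (resp. normal). A block operator $[\tilde A_{ij}]\in\mathbf B(\mathcal K_1\oplus\mathcal K_2)$ is an *entrywise extension* of $[A_{ij}]\in\mathbf B(\mathcal H_1\oplus\mathcal H_2)$, written $[A_{ij}]\preceq[\tilde A_{ij}]$, if $\mathcal H_j\subseteq\mathcal K_j$ and $A_{ij}h_j=\tilde A_{ij}h_j$ for all $h_j\in\mathcal H_j$ and $i,j=1,2$. **Theorem.** Let $\mathcal H_1,\mathcal H_2$ be nonzero Hilbert spaces, let $T=\begin{bmatrix}V&E\\0&S\end{bmatrix}\in\mathbf B(\mathcal H_1\oplus\mathcal H_2)$, and let $\mathcal D$ be a closed subspace of $\mathcal H_1\ominus(\mathcal R(V)\vee\overline{\mathcal R(E)})$. Then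 the following are equivalent: (i) $T\in\mathscr S_{\mathcal H_1,\mathcal H_2}$; (ii) there exist Hilbert spaces $\mathcal K_1,\mathcal K_2$ and $\begin{bmatrix}\tilde V&\tilde E\\0&N\end{bmatrix}\in\mathscr N_{\mathcal K_1,\mathcal K_2}$ such that $T\preceq\begin{bmatrix}\tilde V&\tilde E\\0&N\end{bmatrix}$ and $|E|\subseteq|\tilde E|$; (iii) $S$ is subnormal and, for every minimal normal extension $N\in\mathbf B(\mathcal K_2)$ of $S$, there exist a Hilbert space $\mathcal K_1$ and operators $\tilde V\in\mathbf B(\mathcal K_1)$, $\tilde E\in\mathbf B(\mathcal K_2,\mathcal K_1)$ such that $\begin{bmatrix}\tilde V&\tilde E\\0&N\end{bmatrix}\in\mathscr N_{\mathcal K_1,\mathcal K_2}$, $T\preceq\begin{bmatrix}\tilde V&\tilde E\\0&N\end{bmatrix}$, $|E|\subseteq|\tilde E|$, $\dim\mathcal K_j=\dim\mathcal H_j$ for $j=1,2$, and $\mathcal D=\mathcal K_1\ominus(\mathcal R(\tilde V)\oplus\overline{\mathcal R(\tilde E)})$. Moreover, if $\begin{bmatrix}\tilde V&\tilde E\\0&N\end{bmatrix}$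 is as in (ii) and $N=\mathrm{mne}\,S$, then (a) $|\tilde E|$ is the lift of $|E|$ relative to $\{N\}'$; (b) $E$ is injective (resp. left-invertible with bounded left inverse, isometric) if and only if $\tilde E$ is injective (resp. left-invertible with bounded left inverse, isometric). -/

import Mathlib

open ContinuousLinearMap

universe u

noncomputable section

namespace BrownianType

section Blocks

variable {H₁ H₂ K₁ K₂ : Type u}
  [NormedAddCommGroup H₁] [InnerProductSpace ℂ H₁]
  [NormedAddCommGroup H₂] [InnerProductSpace ℂ H₂]
  [NormedAddCommGroup K₁] [InnerProductSpace ℂ K₁]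
  [NormedAddCommGroup K₂] [InnerProductSpace ℂ K₂]

/-- The orthogonal (Hilbert space) direct sum `H₁ ⊕ H₂`. -/
abbrev HSum (H₁ H₂ : Type u) : Type u := WithLp 2 (H₁ × H₂)

/-- The canonical embedding of `H₁` into `H₁ ⊕ H₂`. -/
def inlL (H₁ H₂ : Type u) [NormedAddCommGroup H₁] [InnerProductSpace ℂ H₁]
    [NormedAddCommGroup H₂] [InnerProductSpace ℂ H₂] : H₁ →L[ℂ] HSum H₁ H₂ :=
  (WithLp.prodContinuousLinearEquiv 2 ℂ H₁ H₂).symm.toContinuousLinearMap ∘L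
    ContinuousLinearMap.inl ℂ H₁ H₂

/-- The canonical embedding of `H₂` into `H₁ ⊕ H₂`. -/
def inrL (H₁ H₂ : Type u) [NormedAddCommGroup H₁] [InnerProductSpace ℂ H₁]
    [NormedAddCommGroup H₂] [InnerProductSpace ℂ H₂] : H₂ →L[ℂ] HSum H₁ H₂ :=
  (WithLp.prodContinuousLinearEquiv 2 ℂ H₁ H₂).symm.toContinuousLinearMap ∘L
    ContinuousLinearMap.inr ℂ H₁ H₂

/-- The operator on `H₁ ⊕ H₂` with block matrix `[[A, B], [C, D]]`. -/
def blockOp (A : H₁ →L[ℂ] H₁) (B : H₂ →L[ℂ] H₁) (C : H₁ →L[ℂ] H₂) (D : H₂ →L[ℂ] H₂) :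
    HSum H₁ H₂ →L[ℂ] HSum H₁ H₂ :=
  inlL H₁ H₂ ∘L (A ∘L WithLp.fstL 2 ℂ H₁ H₂ + B ∘L WithLp.sndL 2 ℂ H₁ H₂) +
    inrL H₁ H₂ ∘L (C ∘L WithLp.fstL 2 ℂ H₁ H₂ + D ∘L WithLp.sndL 2 ℂ H₁ H₂)

/-- The `(1,1)` entry of an operator on `H₁ ⊕ H₂`. -/
def entry11 (T : HSum H₁ H₂ →L[ℂ] HSum H₁ H₂) : H₁ →L[ℂ] H₁ :=
  WithLp.fstL 2 ℂ H₁ H₂ ∘L T ∘L inlL H₁ H₂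

/-- The `(1,2)` entry of an operator on `H₁ ⊕ H₂`. -/
def entry12 (T : HSum H₁ H₂ →L[ℂ] HSum H₁ H₂) : H₂ →L[ℂ] H₁ :=
  WithLp.fstL 2 ℂ H₁ H₂ ∘L T ∘L inrL H₁ H₂

/-- The `(2,1)` entry of an operator on `H₁ ⊕ H₂`. -/
def entry21 (T : HSum H₁ H₂ →L[ℂ] HSum H₁ H₂) : H₁ →L[ℂ] H₂ :=
  WithLp.sndL 2 ℂ H₁ H₂ ∘L T ∘L inlL H₁ H₂

/-- The `(2,2)` entry of an operator on `H₁ ⊕ H₂`. -/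
def entry22 (T : HSum H₁ H₂ →L[ℂ] HSum H₁ H₂) : H₂ →L[ℂ] H₂ :=
  WithLp.sndL 2 ℂ H₁ H₂ ∘L T ∘L inrL H₁ H₂

@[simp] theorem entry11_blockOp (A : H₁ →L[ℂ] H₁) (B : H₂ →L[ℂ] H₁) (C : H₁ →L[ℂ] H₂)
    (D : H₂ →L[ℂ] H₂) : entry11 (blockOp A B C D) = A := by
  ext x; simp [entry11, blockOp, inlL, inrL]

@[simp] theorem entry12_blockOp (A : H₁ →L[ℂ] H₁) (B : H₂ →L[ℂ] H₁) (C : H₁ →L[ℂ] H₂)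
    (D : H₂ →L[ℂ] H₂) : entry12 (blockOp A B C D) = B := by
  ext x; simp [entry12, blockOp, inlL, inrL]

@[simp] theorem entry21_blockOp (A : H₁ →L[ℂ] H₁) (B : H₂ →L[ℂ] H₁) (C : H₁ →L[ℂ] H₂)
    (D : H₂ →L[ℂ] H₂) : entry21 (blockOp A B C D) = C := by
  ext x; simp [entry21, blockOp, inlL, inrL]

@[simp] theorem entry22_blockOp (A : H₁ →L[ℂ] H₁) (B : H₂ →L[ℂ] H₁) (C : H₁ →L[ℂ] H₂)
    (D : H₂ →L[ℂ] H₂) : entry22 (blockOp A B C D) = D := by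
  ext x; simp [entry22, blockOp, inlL, inrL]

/-- `T̃` on `K₁ ⊕ K₂` is an entrywise extension of `T` on `H₁ ⊕ H₂`, where the inclusions
`H_j ⊆ K_j` are the isometric embeddings `ι_j`: each entry `Ã_ij` extends `A_ij`. -/
structure EntrywiseExtends (ι₁ : H₁ →ₗᵢ[ℂ] K₁) (ι₂ : H₂ →ₗᵢ[ℂ] K₂)
    (T : HSum H₁ H₂ →L[ℂ] HSum H₁ H₂) (T' : HSum K₁ K₂ →L[ℂ] HSum K₁ K₂) : Prop where
  ext11 : ∀ h : H₁, ι₁ (entry11 T h) = entry11 T' (ι₁ h)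
  ext12 : ∀ h : H₂, ι₁ (entry12 T h) = entry12 T' (ι₂ h)
  ext21 : ∀ h : H₁, ι₂ (entry21 T h) = entry21 T' (ι₁ h)
  ext22 : ∀ h : H₂, ι₂ (entry22 T h) = entry22 T' (ι₂ h)

end Blocks

section Extensions

variable {H K : Type u} [NormedAddCommGroup H] [InnerProductSpace ℂ H]
  [NormedAddCommGroup K] [InnerProductSpace ℂ K]

/-- `A ⊆ B`: the operator `B` on `K` extends the operator `A` on `H`, where `H` is regarded as
a subspace of `K` through the isometric embedding `ι`. -/
def OpExtends (ι : H →ₗᵢ[ℂ] K) (A : H →L[ℂ] H) (B : K →L[ℂ] K) : Prop :=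
  ∀ h : H, ι (A h) = B (ι h)

/-- `N` on `K` is a normal extension of `S` on `H`. -/
def IsNormalExtension [CompleteSpace K] (ι : H →ₗᵢ[ℂ] K) (S : H →L[ℂ] H)
    (N : K →L[ℂ] K) : Prop :=
  IsStarNormal N ∧ OpExtends ι S N

/-- `S` is subnormal: it has a normal extension acting on some Hilbert space. -/
def IsSubnormal (S : H →L[ℂ] H) : Prop :=
  ∃ (K : Type u) (_ : NormedAddCommGroup K) (_ : InnerProductSpace ℂ K) (_ : CompleteSpace K)
    (ι : H →ₗᵢ[ℂ] K) (N : K →L[ℂ] K), IsNormalExtension ι S N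

/-- The subspace `M` reduces `N`: it is invariant for `N` and `N*`. -/
def Reduces [CompleteSpace K] (M : Submodule ℂ K) (N : K →L[ℂ] K) : Prop :=
  (∀ x ∈ M, N x ∈ M) ∧ (∀ x ∈ M, (adjoint N) x ∈ M)

/-- `N = mne S`: `N` is a normal extension of `S` and `K` is the only closed subspace of `K`
that contains `H` and reduces `N`. -/
def IsMinimalNormalExtension [CompleteSpace K] (ι : H →ₗᵢ[ℂ] K) (S : H →L[ℂ] H)
    (N : K →L[ℂ] K) : Prop :=
  IsNormalExtension ι S N ∧
    ∀ M : Submodule ℂ K, IsClosed (M : Set K) → (∀ h : H, ι h ∈ M) → Reduces M N → M = ⊤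

/-- The orthogonal projection of `K` onto the range of the isometric embedding `ι`, i.e. onto `H`
regarded as a closed subspace of `K`. -/
def rangeProj [CompleteSpace H] (ι : H →ₗᵢ[ℂ] K) : K →L[ℂ] K :=
  haveI : CompleteSpace (LinearMap.range ι.toLinearMap) :=
    (ι.isometry.isUniformInducing.isComplete_range).completeSpace_coe
  (LinearMap.range ι.toLinearMap).starProjection

/-- `B` is the lift of `A` relative to `{N}'`, where `N` is a minimal normal extension of `S` and
`A` is in the commutant of `{S, S*}`: it is the unique operator commuting with `N` and with the
orthogonal projection onto `H` that extends `A`. -/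
structure IsLift [CompleteSpace H] [CompleteSpace K] (ι : H →ₗᵢ[ℂ] K) (S : H →L[ℂ] H)
    (N : K →L[ℂ] K) (A : H →L[ℂ] H) (B : K →L[ℂ] K) : Prop where
  mne : IsMinimalNormalExtension ι S N
  mem_commutant : A ∈ Set.centralizer ({S, adjoint S} : Set (H →L[ℂ] H))
  mem : B ∈ Set.centralizer ({N} : Set (K →L[ℂ] K)) ∩
    Set.centralizer ({rangeProj ι} : Set (K →L[ℂ] K))
  extend : OpExtends ι A B
  unique : ∀ B' ∈ Set.centralizer ({N} : Set (K →L[ℂ] K)) ∩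
    Set.centralizer ({rangeProj ι} : Set (K →L[ℂ] K)), OpExtends ι A B' → B' = B

end Extensions

section Brownian

variable {H K : Type u} [NormedAddCommGroup H] [InnerProductSpace ℂ H] [CompleteSpace H]
  [NormedAddCommGroup K] [InnerProductSpace ℂ K] [CompleteSpace K]

/-- The modulus `|E| = (E*E)^{1/2}`. -/
def modulus (E : H →L[ℂ] K) : H →L[ℂ] H := CFC.sqrt (adjoint E ∘L E)

/-- `E` has a bounded left inverse. -/
def LeftInvertible (E : H →L[ℂ] K) : Prop :=
  ∃ L : K →L[ℂ] H, L ∘L E = ContinuousLinearMap.id ℂ H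

/-- `T` on `H₁ ⊕ H₂` is a Brownian-type operator (relative to this decomposition) whose `(2,2)`
entry belongs to the class `P`. -/
structure IsBrownianTypeOfClass {H₁ H₂ : Type u}
    [NormedAddCommGroup H₁] [InnerProductSpace ℂ H₁] [CompleteSpace H₁]
    [NormedAddCommGroup H₂] [InnerProductSpace ℂ H₂] [CompleteSpace H₂]
    (P : (H₂ →L[ℂ] H₂) → Prop) (T : HSum H₁ H₂ →L[ℂ] HSum H₁ H₂) : Prop where
  nontrivial_fst : Nontrivial H₁
  nontrivial_snd : Nontrivial H₂
  upper_triangular : entry21 T = 0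
  isometric : adjoint (entry11 T) ∘L entry11 T = ContinuousLinearMap.id ℂ H₁
  orthogonal : adjoint (entry11 T) ∘L entry12 T = 0
  commute : entry22 T ∘L (adjoint (entry12 T) ∘L entry12 T) =
    (adjoint (entry12 T) ∘L entry12 T) ∘L entry22 T
  entry22_mem : P (entry22 T)

/-- Brownian-type operators of class `𝒮` (subnormal `(2,2)` entry). -/
def ClassS {H₁ H₂ : Type u}
    [NormedAddCommGroup H₁] [InnerProductSpace ℂ H₁] [CompleteSpace H₁]
    [NormedAddCommGroup H₂] [InnerProductSpace ℂ H₂] [CompleteSpace H₂]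
    (T : HSum H₁ H₂ →L[ℂ] HSum H₁ H₂) : Prop :=
  IsBrownianTypeOfClass (fun X => IsSubnormal X) T

/-- Brownian-type operators of class `𝒩` (normal `(2,2)` entry). -/
def ClassN {H₁ H₂ : Type u}
    [NormedAddCommGroup H₁] [InnerProductSpace ℂ H₁] [CompleteSpace H₁]
    [NormedAddCommGroup H₂] [InnerProductSpace ℂ H₂] [CompleteSpace H₂]
    (T : HSum H₁ H₂ →L[ℂ] HSum H₁ H₂) : Prop :=
  IsBrownianTypeOfClass (fun X => IsStarNormal X) T

/-- The Hilbert space (orthogonal) dimension: the cardinality of a Hilbert basis. All Hilbert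
bases of `H` have the same cardinality, so taking the least one involves no choice. -/
def hilbertDim (H : Type u) [NormedAddCommGroup H] [InnerProductSpace ℂ H] [CompleteSpace H] :
    Cardinal.{u} :=
  sInf {c : Cardinal.{u} | ∃ ι : Type u, Nonempty (HilbertBasis ι ℂ H) ∧ Cardinal.mk ι = c}

end Brownian

end BrownianType

end

/-! Everything rests on lifting `modulus E`, which commutes with `S`, to a minimal normal extension
`N` of `S`. The vectors `N*ⁿ x`, with `x` in the small space, have dense span, and normality gives
`⟪N*ⁿ x, N*ᵐ y⟫ = ⟪Sᵐ x, Sⁿ y⟫`. A self-adjoint `A` commuting with `S` therefore acts symmetrically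
by `N*ⁿ x ↦ N*ⁿ A x`. This action is bounded by `‖A‖`, because `‖A‖² - A²` is the square of another
such operator (`IsNormalExtension.norm_starOrbitMap_mapRange_le`). Lifts respect products, so a
positive operator, being the square of its root, has a positive lift.

Let `B ≥ 0` be the lift of `modulus E` and `P` the projection onto the small space. Since `B` and
`P` commute, `‖B k‖² = ‖E P k‖² + ‖B (1 - P) k‖²`. Hence `E' = E P + q B (1 - P)` has modulus `B` as
soon as `q` is an isometry into a space orthogonal to `ran E`. Take `K₁ = H₁ ⊕ L` and `V' = V ⊕ p`,
where `p` and `q` are isometries that together fill the complement of `ran V + ran E + D`; what the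
ranges of `V'` and `E'` miss is then exactly `D`. Such `p` and `q` exist by a dimension count
(`exists_complement`), which also keeps `dim K₁ = dim H₁`. This gives (i) ⇒ (iii).

(iii) ⇒ (ii) uses the existence of a minimal normal extension, and (ii) ⇒ (i) is restriction. For
the last part, `modulus E'` commutes with `N`, hence with `N*`, so it is the lift of `modulus E`;
injectivity, left invertibility and isometry are read off from the moduli. -/

namespace BrownianType

open scoped InnerProductSpace Cardinal

/-! ### Lifting operators to a minimal normal extension. -/

section StarOrbit

variable {H K : Type u} [NormedAddCommGroup H] [InnerProductSpace ℂ H]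
  [NormedAddCommGroup K] [InnerProductSpace ℂ K] [CompleteSpace K]

/-- The linear map `f ↦ ∑ n, N*ⁿ (ι (f n))` on finitely supported sequences. -/
noncomputable def starOrbitMap (ι : H →ₗᵢ[ℂ] K) (N : K →L[ℂ] K) : (ℕ →₀ H) →ₗ[ℂ] K :=
  Finsupp.lsum ℂ fun n => ((star N) ^ n).toLinearMap ∘ₗ ι.toLinearMap

@[simp] theorem starOrbitMap_single (ι : H →ₗᵢ[ℂ] K) (N : K →L[ℂ] K) (n : ℕ) (h : H) :
    starOrbitMap ι N (Finsupp.single n h) = ((star N) ^ n) (ι h) := by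
  rw [starOrbitMap, Finsupp.lsum_single]; rfl

variable {ι : H →ₗᵢ[ℂ] K} {S : H →L[ℂ] H} {N : K →L[ℂ] K}

omit [CompleteSpace K] in
theorem OpExtends.pow {A : H →L[ℂ] H} {B : K →L[ℂ] K} (h : OpExtends ι A B) (n : ℕ) :
    OpExtends ι (A ^ n) (B ^ n) := by
  induction n with
  | zero => intro x; simp
  | succ n ih => intro x; rw [pow_succ, pow_succ, mul_apply_eq_comp, mul_apply_eq_comp, ← h x, ih (A x)]

omit [CompleteSpace K] in
theorem OpExtends.mul {A A' : H →L[ℂ] H} {B B' : K →L[ℂ] K} (h : OpExtends ι A B)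
    (h' : OpExtends ι A' B') : OpExtends ι (A * A') (B * B') := by
  intro x; rw [mul_apply_eq_comp, mul_apply_eq_comp, ← h' x, h (A' x)]

/-- Move `N*ᵐ` across, commute it past `N*ⁿ` by normality, and move `N*ⁿ` back: only powers of `N`
on the small space remain, where `N` is `S`. Thus `S` alone determines the Gram matrix of the orbit.
-/
theorem IsNormalExtension.inner_star_pow (h : IsNormalExtension ι S N) (m n : ℕ) (x y : H) :
    ⟪((star N) ^ n) (ι x), ((star N) ^ m) (ι y)⟫_ℂ = ⟪(S ^ m) x, (S ^ n) y⟫_ℂ := by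
  have hc : Commute (star N ^ n) (N ^ m) := (h.1.star_comm_self).pow_pow n m
  have hs : ∀ k, (star N) ^ k = adjoint (N ^ k) := fun k => by
    rw [← star_pow, star_eq_adjoint]
  rw [hs m, adjoint_inner_right, ← mul_apply_eq_comp, ← hc.eq, mul_apply_eq_comp, hs n, adjoint_inner_left,
    ← h.2.pow m, ← h.2.pow n, ι.inner_map_map]

/-- The closed span of the orbit contains the small space and reduces `N`: `N*` shifts the exponent,
and `N N*ⁿ x = N*ⁿ S x` by normality. Minimality does the rest. -/
theorem IsMinimalNormalExtension.closure_range_starOrbitMap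
    (h : IsMinimalNormalExtension ι S N) :
    (LinearMap.range (starOrbitMap ι N)).topologicalClosure = ⊤ := by
  have key : ∀ T : K →L[ℂ] K, (∀ n x, T (((star N) ^ n) (ι x)) ∈
      LinearMap.range (starOrbitMap ι N)) →
      ∀ x ∈ (LinearMap.range (starOrbitMap ι N)).topologicalClosure,
        T x ∈ (LinearMap.range (starOrbitMap ι N)).topologicalClosure := by
    intro T hT x hx
    have hmaps : Set.MapsTo T (LinearMap.range (starOrbitMap ι N))
        (LinearMap.range (starOrbitMap ι N)) := by
      rintro _ ⟨f, rfl⟩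
      induction f using Finsupp.induction_linear with
      | zero => simp
      | add f g hf hg => rw [map_add, map_add]; exact Submodule.add_mem _ hf hg
      | single n x => rw [starOrbitMap_single]; exact hT n x
    exact hmaps.closure T.continuous hx
  refine h.2 _ (Submodule.isClosed_topologicalClosure _) (fun x => ?_) ⟨?_, ?_⟩
  · exact Submodule.le_topologicalClosure _ ⟨Finsupp.single 0 x, by simp⟩
  · refine key N fun n x => ⟨Finsupp.single n (S x), ?_⟩
    have hc : Commute (star N ^ n) N := (h.1.1.star_comm_self).pow_left n
    rw [starOrbitMap_single, h.1.2 x, ← mul_apply_eq_comp, hc.eq, mul_apply_eq_comp]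
  · refine key (adjoint N) fun n x => ⟨Finsupp.single (n + 1) x, ?_⟩
    rw [starOrbitMap_single, pow_succ', mul_apply_eq_comp, star_eq_adjoint]

theorem IsMinimalNormalExtension.denseRange_starOrbitMap (h : IsMinimalNormalExtension ι S N) :
    DenseRange (starOrbitMap ι N) := by
  have := h.closure_range_starOrbitMap
  rwa [← Submodule.dense_iff_topologicalClosure_eq_top] at this

theorem IsMinimalNormalExtension.ext {F : Type*} [NormedAddCommGroup F] [NormedSpace ℂ F]
    (h : IsMinimalNormalExtension ι S N)
    {B C : K →L[ℂ] F} (hBC : ∀ n x, B (((star N) ^ n) (ι x)) = C (((star N) ^ n) (ι x))) :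
    B = C := by
  have : (B : K → F) = C := by
    refine h.denseRange_starOrbitMap.equalizer B.continuous C.continuous ?_
    have : B.toLinearMap ∘ₗ starOrbitMap ι N = C.toLinearMap ∘ₗ starOrbitMap ι N := by
      ext n x
      change B (starOrbitMap ι N (Finsupp.single n x)) = C (starOrbitMap ι N (Finsupp.single n x))
      rw [starOrbitMap_single, hBC]
    ext f; exact congrArg (fun g => g f) this
  exact DFunLike.coe_injective this

theorem IsMinimalNormalExtension.eq_zero_of_inner (h : IsMinimalNormalExtension ι S N)
    {v : K} (hv : ∀ n x, ⟪v, ((star N) ^ n) (ι x)⟫_ℂ = 0) : v = 0 := by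
  have : innerSL ℂ v = 0 := h.ext (by simpa using hv)
  simpa using congrArg (fun g => g v) this

/-- `B` acts on the vectors `N*ⁿ (ι x)` as `A` acts on `x`. -/
def IsOrbitLift (ι : H →ₗᵢ[ℂ] K) (N : K →L[ℂ] K) (A : H →L[ℂ] H) (B : K →L[ℂ] K) : Prop :=
  ∀ n x, B (((star N) ^ n) (ι x)) = ((star N) ^ n) (ι (A x))

theorem IsOrbitLift.opExtends {A : H →L[ℂ] H} {B : K →L[ℂ] K} (h : IsOrbitLift ι N A B) :
    OpExtends ι A B := fun x => by simpa using (h 0 x).symm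

theorem OpExtends.isOrbitLift {A : H →L[ℂ] H} {B : K →L[ℂ] K} (h : OpExtends ι A B)
    (hc : Commute (star N) B) : IsOrbitLift ι N A B := fun n x => by
  rw [h x, ← mul_apply_eq_comp, ← mul_apply_eq_comp, (hc.pow_left n).eq]

theorem IsOrbitLift.commute_star (hm : IsMinimalNormalExtension ι S N) {A : H →L[ℂ] H}
    {B : K →L[ℂ] K} (h : IsOrbitLift ι N A B) : Commute (star N) B := by
  refine hm.ext fun n x => ?_
  have e : ∀ z : K, star N (((star N) ^ n) z) = ((star N) ^ (n + 1)) z := fun z => by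
    rw [pow_succ', mul_apply_eq_comp]
  rw [mul_apply_eq_comp, mul_apply_eq_comp, h n x, e, e, h (n + 1) x]

theorem IsOrbitLift.mul {A A' : H →L[ℂ] H} {B B' : K →L[ℂ] K}
    (h : IsOrbitLift ι N A B) (h' : IsOrbitLift ι N A' B') :
    IsOrbitLift ι N (A * A') (B * B') := fun n x => by
  rw [mul_apply_eq_comp, h' n x, h n, mul_apply_eq_comp]

theorem IsOrbitLift.unique (hm : IsMinimalNormalExtension ι S N) {A : H →L[ℂ] H}
    {B B' : K →L[ℂ] K} (h : IsOrbitLift ι N A B) (h' : IsOrbitLift ι N A B') : B = B' :=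
  hm.ext fun n x => by rw [h n x, h' n x]

theorem isOrbitLift_one : IsOrbitLift ι N 1 1 := fun n x => by simp

variable [CompleteSpace H]

theorem inner_pow_symm {A : H →L[ℂ] H} (hA : IsSelfAdjoint A) (hS : Commute A S)
    (m n : ℕ) (x y : H) : ⟪(S ^ m) (A x), (S ^ n) y⟫_ℂ = ⟪(S ^ m) x, (S ^ n) (A y)⟫_ℂ := by
  rw [← mul_apply_eq_comp, ← (hS.pow_right m).eq, mul_apply_eq_comp, ← mul_apply_eq_comp (S ^ n),
    ← (hS.pow_right n).eq, mul_apply_eq_comp]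
  exact hA.isSymmetric _ _

theorem IsOrbitLift.isSelfAdjoint (hm : IsMinimalNormalExtension ι S N) {A : H →L[ℂ] H}
    (hA : IsSelfAdjoint A) (hS : Commute A S)
    {B : K →L[ℂ] K} (h : IsOrbitLift ι N A B) : IsSelfAdjoint B := by
  rw [isSelfAdjoint_iff']
  refine hm.ext fun n x => ?_
  rw [← sub_eq_zero]
  refine hm.eq_zero_of_inner fun m y => ?_
  rw [inner_sub_left, adjoint_inner_left, h m y, h n x, hm.1.inner_star_pow,
    hm.1.inner_star_pow, inner_pow_symm hA hS, sub_self]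

theorem IsNormalExtension.inner_starOrbitMap_symm (h : IsNormalExtension ι S N)
    {A : H →L[ℂ] H} (hA : IsSelfAdjoint A) (hS : Commute A S) (f g : ℕ →₀ H) :
    ⟪starOrbitMap ι N (f.mapRange A (map_zero A)), starOrbitMap ι N g⟫_ℂ =
      ⟪starOrbitMap ι N f, starOrbitMap ι N (g.mapRange A (map_zero A))⟫_ℂ := by
  induction f using Finsupp.induction_linear with
  | zero => simp
  | add f₁ f₂ h₁ h₂ =>
    rw [Finsupp.mapRange_add (map_add A), map_add, map_add, inner_add_left, inner_add_left, h₁, h₂]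
  | single n x =>
    induction g using Finsupp.induction_linear with
    | zero => simp
    | add g₁ g₂ h₁ h₂ =>
      rw [Finsupp.mapRange_add (map_add A), map_add, map_add, inner_add_right, inner_add_right,
        h₁, h₂]
    | single m y =>
      rw [Finsupp.mapRange_single, Finsupp.mapRange_single]
      simp only [starOrbitMap_single]
      rw [h.inner_star_pow, h.inner_star_pow, inner_pow_symm hA hS]

theorem commute_sqrt {𝓗 : Type*} [NormedAddCommGroup 𝓗] [InnerProductSpace ℂ 𝓗]
    [CompleteSpace 𝓗] {P T : 𝓗 →L[ℂ] 𝓗} (hP : 0 ≤ P) (h : Commute P T) :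
    Commute (CFC.sqrt P) T := by
  rw [CFC.sqrt_eq_real_sqrt P hP]
  exact (IsSelfAdjoint.of_nonneg hP).commute_cfcₙ h _

/-- With `C² = ‖A‖² - A²` and `C` commuting with `S`, symmetry of the two actions gives `‖A‖² ‖f‖² -
‖A f‖² = ‖C f‖² ≥ 0`, norms being those of the images in `K`. This also shows that the action on the
orbit span is well defined. -/
theorem IsNormalExtension.norm_starOrbitMap_mapRange_le (h : IsNormalExtension ι S N)
    {A : H →L[ℂ] H} (hA : IsSelfAdjoint A) (hS : Commute A S) (f : ℕ →₀ H) :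
    ‖starOrbitMap ι N (f.mapRange A (map_zero A))‖ ≤ ‖A‖ * ‖starOrbitMap ι N f‖ := by
  set R : H →L[ℂ] H := algebraMap ℝ (H →L[ℂ] H) (‖A‖ ^ 2) - A * A with hR
  have hR0 : 0 ≤ R := by
    have := CStarAlgebra.star_mul_le_algebraMap_norm_sq (a := A)
    rw [hA.star_eq] at this
    exact sub_nonneg.2 this
  have hRS : Commute R S :=
    Commute.sub_left (Algebra.commutes _ _) (hS.mul_left hS)
  set C := CFC.sqrt R
  have hC : IsSelfAdjoint C := IsSelfAdjoint.of_nonneg (CFC.sqrt_nonneg R)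
  have hCC : C * C = R := CFC.sqrt_mul_sqrt_self R hR0
  have hCS : Commute C S := commute_sqrt hR0 hRS
  have e1 := h.inner_starOrbitMap_symm hA hS (f.mapRange A (map_zero A)) f
  have e2 := h.inner_starOrbitMap_symm hC hCS (f.mapRange C (map_zero C)) f
  have e3 : (f.mapRange C (map_zero C)).mapRange C (map_zero C) =
      ((‖A‖ ^ 2 : ℝ) : ℂ) • f - (f.mapRange A (map_zero A)).mapRange A (map_zero A) := by
    ext n
    have := congrArg (fun T : H →L[ℂ] H => T (f n)) hCC
    simp only [mul_apply_eq_comp, hR, sub_apply] at this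
    simp only [Finsupp.mapRange_apply, Finsupp.sub_apply, Finsupp.smul_apply, this]
    simp only [Algebra.algebraMap_eq_smul_one, smul_apply, one_apply_eq_self, Complex.coe_smul]
  rw [e3, map_sub, map_smul, inner_sub_left, e1, inner_smul_left] at e2
  have e4 := congrArg Complex.re e2
  simp only [inner_self_eq_norm_sq_to_K] at e4
  have e5 : ‖A‖ ^ 2 * ‖starOrbitMap ι N f‖ ^ 2 -
      ‖starOrbitMap ι N (f.mapRange A (map_zero A))‖ ^ 2 =
      ‖starOrbitMap ι N (f.mapRange C (map_zero C))‖ ^ 2 := by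
    have e6 : ((‖A‖ ^ 2 * ‖starOrbitMap ι N f‖ ^ 2 -
      ‖starOrbitMap ι N (f.mapRange A (map_zero A))‖ ^ 2 : ℝ) : ℂ) =
      ((‖starOrbitMap ι N (f.mapRange C (map_zero C))‖ ^ 2 : ℝ) : ℂ) := by
      simp only [inner_self_eq_norm_sq_to_K, Complex.conj_ofReal] at e2
      push_cast
      simpa using e2
    exact_mod_cast e6
  refine abs_le_of_sq_le_sq' ?_ (by positivity) |>.2
  rw [mul_pow]
  nlinarith [sq_nonneg ‖starOrbitMap ι N (f.mapRange C (map_zero C))‖]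

theorem IsMinimalNormalExtension.exists_isOrbitLift (hm : IsMinimalNormalExtension ι S N)
    {A : H →L[ℂ] H} (hA : IsSelfAdjoint A) (hS : Commute A S) :
    ∃ B : K →L[ℂ] K, IsOrbitLift ι N A B := by
  let φ : (ℕ →₀ H) →ₗ[ℂ] K := starOrbitMap ι N ∘ₗ Finsupp.mapRange.linearMap A.toLinearMap
  have hφ : ∀ f, ‖φ f‖ ≤ ‖A‖ * ‖starOrbitMap ι N f‖ := fun f =>
    hm.1.norm_starOrbitMap_mapRange_le hA hS f
  refine ⟨φ.extendOfNorm (starOrbitMap ι N), fun n x => ?_⟩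
  have := LinearMap.extendOfNorm_eq hm.denseRange_starOrbitMap ⟨_, hφ⟩ (Finsupp.single n x)
  rw [starOrbitMap_single] at this
  rw [this]
  simp [φ]

theorem IsMinimalNormalExtension.exists_nonneg_isOrbitLift (hm : IsMinimalNormalExtension ι S N)
    {A : H →L[ℂ] H} (hA : 0 ≤ A) (hS : Commute A S) :
    ∃ B : K →L[ℂ] K, 0 ≤ B ∧ IsOrbitLift ι N A B := by
  have hC : IsSelfAdjoint (CFC.sqrt A) := IsSelfAdjoint.of_nonneg (CFC.sqrt_nonneg A)
  have hCS := commute_sqrt hA hS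
  obtain ⟨B, hB⟩ := hm.exists_isOrbitLift hC hCS
  refine ⟨B * B, ?_, ?_⟩
  · have := star_mul_self_nonneg B
    rwa [(hB.isSelfAdjoint hm hC hCS).star_eq] at this
  · have := hB.mul hB
    rwa [CFC.sqrt_mul_sqrt_self A hA] at this

end StarOrbit

/-! ### Orthogonal dimension and its arithmetic. -/

section Dimension

variable {X Y : Type u} [NormedAddCommGroup X] [InnerProductSpace ℂ X]
  [NormedAddCommGroup Y] [InnerProductSpace ℂ Y]

/-- By Bessel, each `s b` has nonzero inner product with only countably many `v a`, and by
hypothesis these countable sets cover `α`. -/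
theorem mk_le_of_orthonormal {α β : Type u} {v : α → X} (hv : Orthonormal ℂ v) (s : β → X)
    (h : ∀ a, ∃ b, ⟪v a, s b⟫_ℂ ≠ 0) : #α ≤ #β * ℵ₀ := by
  have hU : (⋃ b, {a | ⟪v a, s b⟫_ℂ ≠ 0}) = Set.univ := by
    ext a; simpa using h a
  rw [← Cardinal.mk_univ, ← hU]
  refine (Cardinal.mk_iUnion_le _).trans (mul_le_mul_right (ciSup_le' fun b => ?_) _)
  have := (hv.inner_products_summable (s b)).countable_support
  refine Cardinal.le_aleph0_iff_set_countable.2 (this.mono fun a ha => ?_)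
  simpa using ha

theorem hilbertBasis_exists_inner_ne_zero {α : Type*} (b : HilbertBasis α ℂ X) {x : X}
    (hx : x ≠ 0) : ∃ a, ⟪x, b a⟫_ℂ ≠ 0 := by
  by_contra! h
  apply hx
  rw [← map_eq_zero_iff b.repr b.repr.injective]
  ext a
  rw [b.repr_apply_apply, ← inner_conj_symm, h a]
  simp

theorem finiteDimensional_of_hilbertBasis {α : Type*} [Finite α] (b : HilbertBasis α ℂ X) :
    FiniteDimensional ℂ X := by
  have := Fintype.ofFinite α
  exact b.toOrthonormalBasis.toBasis.finiteDimensional_of_finite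

theorem mk_le_mk_of_hilbertBasis {α β : Type u} (b : HilbertBasis α ℂ X)
    (c : HilbertBasis β ℂ X) : #α ≤ #β := by
  cases finite_or_infinite β with
  | inl hβ =>
    have := finiteDimensional_of_hilbertBasis c
    have : Finite α := b.orthonormal.linearIndependent.finite
    have := Fintype.ofFinite α
    have := Fintype.ofFinite β
    rw [Cardinal.mk_fintype, Cardinal.mk_fintype,
      ← Module.finrank_eq_card_basis b.toOrthonormalBasis.toBasis,
      ← Module.finrank_eq_card_basis c.toOrthonormalBasis.toBasis]
  | inr hβ =>
    refine (mk_le_of_orthonormal b.orthonormal c fun a =>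
      hilbertBasis_exists_inner_ne_zero c (b.orthonormal.ne_zero a)).trans ?_
    rw [Cardinal.mul_aleph0_eq (Cardinal.aleph0_le_mk β)]

variable [CompleteSpace X] [CompleteSpace Y]

theorem exists_hilbertBasis_type (X : Type u) [NormedAddCommGroup X] [InnerProductSpace ℂ X]
    [CompleteSpace X] : ∃ α : Type u, Nonempty (HilbertBasis α ℂ X) := by
  obtain ⟨w, b, -⟩ := exists_hilbertBasis ℂ X
  exact ⟨w, ⟨b⟩⟩

theorem hilbertDim_eq_mk {α : Type u} (b : HilbertBasis α ℂ X) : hilbertDim X = #α := by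
  have : {c : Cardinal.{u} | ∃ ι : Type u, Nonempty (HilbertBasis ι ℂ X) ∧ Cardinal.mk ι = c} =
      {#α} := by
    ext c
    constructor
    · rintro ⟨β, ⟨d⟩, rfl⟩
      exact le_antisymm (mk_le_mk_of_hilbertBasis d b) (mk_le_mk_of_hilbertBasis b d)
    · rintro rfl
      exact ⟨α, ⟨b⟩, rfl⟩
  rw [hilbertDim, this, csInf_singleton]

omit [CompleteSpace X] in
/-- Transport of a Hilbert basis along a linear isometric equivalence and a bijection. -/
theorem exists_hilbertBasis_of_equiv {α β : Type u} (b : HilbertBasis α ℂ X)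
    (e : X ≃ₗᵢ[ℂ] Y) (f : β ≃ α) : Nonempty (HilbertBasis β ℂ Y) := by
  have ho : Orthonormal ℂ (fun i => e (b (f i))) :=
    (b.orthonormal.comp_linearIsometryEquiv e).comp f f.injective
  refine ⟨HilbertBasis.mkOfOrthogonalEqBot ho ?_⟩
  rw [Submodule.eq_bot_iff]
  intro y hy
  by_contra hne
  obtain ⟨a, ha⟩ := hilbertBasis_exists_inner_ne_zero b (x := e.symm y) (by simpa using hne)
  apply ha
  rw [← e.inner_map_map, e.apply_symm_apply]
  have := (Submodule.mem_orthogonal' _ _).1 hy _ (Submodule.subset_span ⟨f.symm a, rfl⟩)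
  simpa using this

theorem hilbertDim_congr (e : X ≃ₗᵢ[ℂ] Y) : hilbertDim X = hilbertDim Y := by
  obtain ⟨α, ⟨b⟩⟩ := exists_hilbertBasis_type X
  obtain ⟨c⟩ := exists_hilbertBasis_of_equiv b e (Equiv.refl α)
  rw [hilbertDim_eq_mk b, hilbertDim_eq_mk c]

theorem nonempty_linearIsometryEquiv (h : hilbertDim X = hilbertDim Y) :
    Nonempty (X ≃ₗᵢ[ℂ] Y) := by
  obtain ⟨α, ⟨b⟩⟩ := exists_hilbertBasis_type X
  obtain ⟨β, ⟨c⟩⟩ := exists_hilbertBasis_type Y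
  rw [hilbertDim_eq_mk b, hilbertDim_eq_mk c] at h
  obtain ⟨f⟩ := Cardinal.eq.1 h
  obtain ⟨d⟩ := exists_hilbertBasis_of_equiv c (LinearIsometryEquiv.refl ℂ Y) f
  exact ⟨b.repr.trans d.repr.symm⟩

theorem hilbertDim_le_of_family {β : Type u} (s : β → X)
    (h : ∀ x, (∀ b, ⟪x, s b⟫_ℂ = 0) → x = 0) : hilbertDim X ≤ #β * ℵ₀ := by
  obtain ⟨α, ⟨b⟩⟩ := exists_hilbertBasis_type X
  rw [hilbertDim_eq_mk b]
  refine mk_le_of_orthonormal b.orthonormal s fun a => ?_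
  by_contra! hc
  exact b.orthonormal.ne_zero a (h _ hc)

theorem aleph0_le_hilbertDim (h : ¬ FiniteDimensional ℂ X) : ℵ₀ ≤ hilbertDim X := by
  obtain ⟨α, ⟨b⟩⟩ := exists_hilbertBasis_type X
  rw [hilbertDim_eq_mk b]
  by_contra! hc
  have : Finite α := Cardinal.lt_aleph0_iff_finite.1 hc
  exact h (finiteDimensional_of_hilbertBasis b)

theorem hilbertDim_le_of_isometry (e : X →ₗᵢ[ℂ] Y) (hY : ¬ FiniteDimensional ℂ Y) :
    hilbertDim X ≤ hilbertDim Y := by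
  obtain ⟨α, ⟨b⟩⟩ := exists_hilbertBasis_type X
  obtain ⟨β, ⟨c⟩⟩ := exists_hilbertBasis_type Y
  have h := mk_le_of_orthonormal (b.orthonormal.comp_linearIsometry e) c fun a =>
      hilbertBasis_exists_inner_ne_zero c
        ((b.orthonormal.comp_linearIsometry e).ne_zero a)
  have hβ := aleph0_le_hilbertDim hY
  rw [hilbertDim_eq_mk c] at hβ
  rw [hilbertDim_eq_mk b, hilbertDim_eq_mk c]
  rwa [Cardinal.mul_aleph0_eq hβ] at h

theorem exists_hilbertBasis_prod {α β : Type u} (b : HilbertBasis α ℂ X)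
    (c : HilbertBasis β ℂ Y) : Nonempty (HilbertBasis (α ⊕ β) ℂ (WithLp 2 (X × Y))) := by
  let v : α ⊕ β → WithLp 2 (X × Y) :=
    Sum.elim (fun a => WithLp.toLp 2 (b a, 0)) (fun a => WithLp.toLp 2 (0, c a))
  have ho : Orthonormal ℂ v := by
    classical
    rw [orthonormal_iff_ite]
    have hb := orthonormal_iff_ite.1 b.orthonormal
    have hc := orthonormal_iff_ite.1 c.orthonormal
    rintro (i | i) (j | j) <;> simp [v, WithLp.prod_inner_apply, hb, hc]
  refine ⟨HilbertBasis.mkOfOrthogonalEqBot ho ?_⟩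
  rw [Submodule.eq_bot_iff]
  intro y hy
  have hy' : ∀ i, ⟪y, v i⟫_ℂ = 0 := fun i =>
    (Submodule.mem_orthogonal' _ _).1 hy _ (Submodule.subset_span ⟨i, rfl⟩)
  have h1 : y.fst = 0 := by
    by_contra hne
    obtain ⟨a, ha⟩ := hilbertBasis_exists_inner_ne_zero b hne
    exact ha (by simpa [v, WithLp.prod_inner_apply] using hy' (Sum.inl a))
  have h2 : y.snd = 0 := by
    by_contra hne
    obtain ⟨a, ha⟩ := hilbertBasis_exists_inner_ne_zero c hne
    exact ha (by simpa [v, WithLp.prod_inner_apply] using hy' (Sum.inr a))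
  exact WithLp.ofLp_injective 2 (Prod.ext h1 h2)

theorem hilbertDim_prod : hilbertDim (WithLp 2 (X × Y)) = hilbertDim X + hilbertDim Y := by
  obtain ⟨α, ⟨b⟩⟩ := exists_hilbertBasis_type X
  obtain ⟨β, ⟨c⟩⟩ := exists_hilbertBasis_type Y
  obtain ⟨d⟩ := exists_hilbertBasis_prod b c
  rw [hilbertDim_eq_mk b, hilbertDim_eq_mk c, hilbertDim_eq_mk d]
  simp

theorem hilbertDim_eq_zero [Subsingleton X] : hilbertDim X = 0 := by
  obtain ⟨α, ⟨b⟩⟩ := exists_hilbertBasis_type X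
  rw [hilbertDim_eq_mk b, Cardinal.mk_eq_zero_iff]
  exact ⟨fun a => b.orthonormal.ne_zero a (Subsingleton.elim _ _)⟩

end Dimension

/-! ### The modulus of an operator. -/

section Modulus

variable {H K : Type u} [NormedAddCommGroup H] [InnerProductSpace ℂ H] [CompleteSpace H]
  [NormedAddCommGroup K] [InnerProductSpace ℂ K] [CompleteSpace K]

theorem adjoint_comp_self_nonneg (E : H →L[ℂ] K) : 0 ≤ adjoint E ∘L E :=
  (nonneg_iff_isPositive _).2 (isPositive_adjoint_comp_self E)

theorem modulus_nonneg (E : H →L[ℂ] K) : 0 ≤ modulus E := CFC.sqrt_nonneg _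

theorem modulus_isSelfAdjoint (E : H →L[ℂ] K) : IsSelfAdjoint (modulus E) :=
  IsSelfAdjoint.of_nonneg (modulus_nonneg E)

theorem modulus_mul_self (E : H →L[ℂ] K) : modulus E * modulus E = adjoint E ∘L E :=
  CFC.sqrt_mul_sqrt_self _ (adjoint_comp_self_nonneg E)

theorem modulus_apply_apply (E : H →L[ℂ] K) (x : H) :
    modulus E (modulus E x) = adjoint E (E x) := by
  rw [← mul_apply_eq_comp, modulus_mul_self]; rfl

theorem inner_modulus (E : H →L[ℂ] K) (x y : H) :
    ⟪modulus E x, modulus E y⟫_ℂ = ⟪E x, E y⟫_ℂ := by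
  rw [← adjoint_inner_left E, ← modulus_apply_apply]
  exact ((modulus_isSelfAdjoint E).isSymmetric _ _).symm

theorem norm_modulus (E : H →L[ℂ] K) (x : H) : ‖modulus E x‖ = ‖E x‖ := by
  have h := inner_modulus E x x
  rw [inner_self_eq_norm_sq_to_K, inner_self_eq_norm_sq_to_K] at h
  have h' : ‖modulus E x‖ ^ 2 = ‖E x‖ ^ 2 := by exact_mod_cast h
  exact (sq_eq_sq₀ (norm_nonneg _) (norm_nonneg _)).1 h'

theorem modulus_apply_eq_zero_iff (E : H →L[ℂ] K) (x : H) : modulus E x = 0 ↔ E x = 0 := by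
  rw [← norm_eq_zero, norm_modulus, norm_eq_zero]

/-- Over `ℂ` a quadratic form determines its operator, so `B² = E*E`; the positive root is unique.
-/
theorem modulus_eq_of_norm_eq {E : H →L[ℂ] K} {B : H →L[ℂ] H} (hB : 0 ≤ B)
    (h : ∀ x, ‖B x‖ = ‖E x‖) : modulus E = B := by
  refine CFC.sqrt_unique ?_ hB
  have hs : IsSelfAdjoint B := IsSelfAdjoint.of_nonneg hB
  have key : ((B * B).toLinearMap - (adjoint E ∘L E).toLinearMap) = 0 := by
    refine (inner_map_self_eq_zero _).1 fun x => ?_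
    have h1 : ⟪B (B x), x⟫_ℂ = ⟪B x, B x⟫_ℂ := hs.isSymmetric _ _
    have h2 : ⟪adjoint E (E x), x⟫_ℂ = ⟪E x, E x⟫_ℂ := adjoint_inner_left _ _ _
    change ⟪B (B x) - adjoint E (E x), x⟫_ℂ = 0
    rw [inner_sub_left, h1, h2, inner_self_eq_norm_sq_to_K, inner_self_eq_norm_sq_to_K, h x,
      sub_self]
  ext x
  exact sub_eq_zero.1 (congrArg (fun T => T x) key)

theorem commute_modulus {E : H →L[ℂ] K} {S : H →L[ℂ] H}
    (h : S ∘L (adjoint E ∘L E) = (adjoint E ∘L E) ∘L S) : Commute (modulus E) S :=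
  have hc : Commute (adjoint E ∘L E) S := by
    rw [commute_iff_eq, mul_def, mul_def]; exact h.symm
  commute_sqrt (adjoint_comp_self_nonneg E) hc

/-- A left inverse bounds `E` from below, so the form of `E*E` is bounded below and `E*E = |E|²` is
invertible. -/
theorem LeftInvertible.isUnit_modulus {E : H →L[ℂ] K} (h : LeftInvertible E) :
    IsUnit (modulus E) := by
  obtain ⟨L, hL⟩ := h
  have hu : IsUnit (adjoint E ∘L E) := by
    obtain ⟨c, hc, hb⟩ : ∃ c : NNReal, 0 < c ∧ ∀ x, ‖x‖ * c ≤ ‖E x‖ := by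
      -- The added `1` keeps the constant meaningful when `L = 0`.
      refine ⟨(‖L‖₊ + 1)⁻¹, by positivity, fun x => ?_⟩
      have hLx : L (E x) = x := congrArg (fun T => T x) hL
      have h1 : ‖x‖ ≤ ‖L‖ * ‖E x‖ := by
        conv_lhs => rw [← hLx]
        exact L.le_opNorm _
      rw [NNReal.coe_inv, ← div_eq_mul_inv, div_le_iff₀ (by positivity)]
      push_cast
      nlinarith [norm_nonneg (E x)]
    have hd : ∀ x, ‖x‖ ^ 2 * (c ^ 2 : NNReal) ≤ ‖⟪(adjoint E ∘L E) x, x⟫_ℂ‖ := by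
      intro x
      have h2 : ⟪(adjoint E ∘L E) x, x⟫_ℂ = ⟪E x, E x⟫_ℂ := by
        rw [comp_apply, adjoint_inner_left]
      have h3 : ‖⟪E x, E x⟫_ℂ‖ = ‖E x‖ ^ 2 := by
        rw [inner_self_eq_norm_sq_to_K]; simp
      rw [h2, h3, NNReal.coe_pow, ← mul_pow]
      exact pow_le_pow_left₀ (mul_nonneg (norm_nonneg x) c.2) (hb x) 2
    have hc2 : 0 < c ^ 2 := pow_pos hc 2
    generalize c ^ 2 = d at hd hc2
    exact isUnit_of_forall_le_norm_inner_map (adjoint E ∘L E) hc2 hd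
  rw [← modulus_mul_self] at hu
  exact isUnit_mul_self_iff.1 hu

end Modulus

/-! ### Existence and dimension of minimal normal extensions. -/

section Reducing

variable {H K : Type u} [NormedAddCommGroup H] [InnerProductSpace ℂ H]
  [NormedAddCommGroup K] [InnerProductSpace ℂ K] [CompleteSpace K]
  {ι : H →ₗᵢ[ℂ] K} {S : H →L[ℂ] H} {N : K →L[ℂ] K}

/-- A trace argument: `r x` is the part of `N* x` orthogonal to `H`, and `‖S x‖² = ‖S* x‖² + ‖r
x‖²`. Since `S` and `S*` have the same Hilbert–Schmidt norm, `r` vanishes, so `H` already reduces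
`N`. -/
theorem IsMinimalNormalExtension.surjective_of_finiteDimensional [FiniteDimensional ℂ H]
    (h : IsMinimalNormalExtension ι S N) : Function.Surjective ι := by
  have : CompleteSpace H := FiniteDimensional.complete ℂ H
  let J : H →L[ℂ] K := ι.toContinuousLinearMap
  have hJJ : ∀ x, adjoint J (J x) = x := fun x =>
    congrArg (fun T : H →L[ℂ] H => T x) ι.adjoint_comp_self
  have hS : ∀ x, adjoint J (adjoint N (J x)) = adjoint S x := fun x => by
    refine ext_inner_right ℂ fun y => ?_
    rw [adjoint_inner_left, adjoint_inner_left, adjoint_inner_left]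
    change ⟪J x, N (ι y)⟫_ℂ = _
    rw [← h.1.2 y]
    exact ι.inner_map_map _ _
  let r : H → K := fun x => adjoint N (J x) - J (adjoint S x)
  have hpy : ∀ x, ‖S x‖ ^ 2 = ‖adjoint S x‖ ^ 2 + ‖r x‖ ^ 2 := fun x => by
    have h1 : ‖adjoint N (J x)‖ = ‖S x‖ := by
      rw [← isStarNormal_iff_norm_eq_adjoint.1 h.1.1 (J x), ← ι.norm_map (S x), h.1.2 x]; rfl
    have h2 : adjoint N (J x) = J (adjoint S x) + r x := by simp [r]
    have h3 : ⟪J (adjoint S x), r x⟫_ℂ = 0 := by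
      rw [← adjoint_inner_right, map_sub, hJJ, hS, sub_self, inner_zero_right]
    have h4 := norm_add_sq_eq_norm_sq_add_norm_sq_of_inner_eq_zero _ _ h3
    have h5 : ‖J (adjoint S x)‖ = ‖adjoint S x‖ := ι.norm_map _
    rw [← h2, h1, h5] at h4
    nlinarith
  let b := stdOrthonormalBasis ℂ H
  have htr : ∑ i, ‖S (b i)‖ ^ 2 = ∑ i, ‖adjoint S (b i)‖ ^ 2 := by
    calc ∑ i, ‖S (b i)‖ ^ 2 = ∑ i, ∑ j, ‖⟪b j, S (b i)⟫_ℂ‖ ^ 2 :=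
          Finset.sum_congr rfl fun i _ => (b.sum_sq_norm_inner_right _).symm
      _ = ∑ j, ∑ i, ‖⟪adjoint S (b j), b i⟫_ℂ‖ ^ 2 := by
          rw [Finset.sum_comm]
          simp only [adjoint_inner_left]
      _ = _ := Finset.sum_congr rfl fun i _ => b.sum_sq_norm_inner_left _
  have hr : ∀ i, r (b i) = 0 := by
    have h0 : ∑ i, ‖r (b i)‖ ^ 2 = 0 := by
      have := Finset.sum_congr rfl fun i (_ : i ∈ Finset.univ) => hpy (b i)
      rw [Finset.sum_add_distrib, htr] at this
      linarith
    intro i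
    have := (Finset.sum_eq_zero_iff_of_nonneg fun i _ => sq_nonneg _).1 h0 i (Finset.mem_univ i)
    simpa using this
  have hr' : (adjoint N ∘L J - J ∘L adjoint S).toLinearMap = 0 :=
    b.toBasis.ext fun i => by simpa [r] using hr i
  have htop : LinearMap.range ι.toLinearMap = ⊤ := by
    refine h.2 _ (Submodule.closed_of_finiteDimensional _) (fun x => ⟨x, rfl⟩) ⟨?_, ?_⟩
    · rintro _ ⟨x, rfl⟩
      exact ⟨S x, h.1.2 x⟩
    · rintro _ ⟨x, rfl⟩
      refine ⟨adjoint S x, ?_⟩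
      have := congrArg (fun T => T x) hr'
      exact (sub_eq_zero.1 this).symm
  exact LinearMap.range_eq_top.1 htop

theorem IsMinimalNormalExtension.hilbertDim_eq [CompleteSpace H]
    (h : IsMinimalNormalExtension ι S N) : hilbertDim K = hilbertDim H := by
  by_cases hH : FiniteDimensional ℂ H
  · exact (hilbertDim_congr (LinearIsometryEquiv.ofSurjective ι
      h.surjective_of_finiteDimensional)).symm
  · have hK : ¬ FiniteDimensional ℂ K := fun hK =>
      hH (FiniteDimensional.of_injective ι.toLinearMap ι.injective)
    refine le_antisymm ?_ (hilbertDim_le_of_isometry ι hK)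
    have hinf := aleph0_le_hilbertDim hH
    obtain ⟨α, ⟨b⟩⟩ := exists_hilbertBasis_type H
    rw [hilbertDim_eq_mk b] at hinf ⊢
    -- The vectors `N*ⁿ (b a)` are total in `K`, and there are only `ℵ₀ · dim H = dim H` of them.
    refine (hilbertDim_le_of_family
      (fun p : ℕ × α => ((star N) ^ p.1) (ι (b p.2))) fun x hx => ?_).trans ?_
    · refine h.eq_zero_of_inner fun n y => ?_
      let T : H →L[ℂ] K := ((star N) ^ n) ∘L ι.toContinuousLinearMap
      have hT : adjoint T x = 0 := by
        by_contra hne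
        obtain ⟨a, ha⟩ := hilbertBasis_exists_inner_ne_zero b hne
        rw [adjoint_inner_left] at ha
        exact ha (hx (n, a))
      change ⟪x, T y⟫_ℂ = 0
      rw [← adjoint_inner_left, hT, inner_zero_left]
    · simp [Cardinal.aleph0_mul_eq hinf, Cardinal.mul_aleph0_eq hinf]

/-- Restrict any normal extension to the intersection of all closed reducing subspaces containing
`H`. -/
theorem exists_isMinimalNormalExtension {H : Type u} [NormedAddCommGroup H]
    [InnerProductSpace ℂ H] {S : H →L[ℂ] H} (h : IsSubnormal S) :
    ∃ (K : Type u) (_ : NormedAddCommGroup K) (_ : InnerProductSpace ℂ K) (_ : CompleteSpace K)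
      (ι : H →ₗᵢ[ℂ] K) (N : K →L[ℂ] K), IsMinimalNormalExtension ι S N := by
  obtain ⟨K, _, _, _, ι, N, hN, hS⟩ := h
  let 𝒞 : Set (Submodule ℂ K) :=
    {M | IsClosed (M : Set K) ∧ (∀ x, ι x ∈ M) ∧ Reduces M N}
  let M : Submodule ℂ K := sInf 𝒞
  have hMc : IsClosed (M : Set K) := by
    rw [Submodule.coe_sInf]
    exact isClosed_biInter fun L hL => hL.1
  have hMι : ∀ x, ι x ∈ M := fun x => Submodule.mem_sInf.2 fun L hL => hL.2.1 x
  have hMN : ∀ x ∈ M, N x ∈ M := fun x hx =>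
    Submodule.mem_sInf.2 fun L hL => hL.2.2.1 x (Submodule.mem_sInf.1 hx L hL)
  have hMN' : ∀ x ∈ M, adjoint N x ∈ M := fun x hx =>
    Submodule.mem_sInf.2 fun L hL => hL.2.2.2 x (Submodule.mem_sInf.1 hx L hL)
  have hcomp : CompleteSpace M := hMc.completeSpace_coe
  let NM : M →L[ℂ] M := (N ∘L M.subtypeL).codRestrict M fun x => hMN _ x.2
  let NM' : M →L[ℂ] M := (adjoint N ∘L M.subtypeL).codRestrict M fun x => hMN' _ x.2
  have hadj : NM' = adjoint NM := by
    rw [eq_adjoint_iff]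
    intro x y
    exact adjoint_inner_left N (y : K) (x : K)
  let ιM : H →ₗᵢ[ℂ] M :=
    { toLinearMap := ι.toLinearMap.codRestrict M hMι
      norm_map' := fun x => ι.norm_map x }
  refine ⟨M, inferInstance, inferInstance, hcomp, ιM, NM, ⟨⟨?_⟩, ?_⟩, ?_⟩
  · rw [star_eq_adjoint, ← hadj]
    ext x
    exact congrArg (fun T : K →L[ℂ] K => T x) hN.star_comm_self
  · intro x
    exact Subtype.ext (hS x)
  · intro L hLc hLι hLN
    have hmem : L.map M.subtype ∈ 𝒞 := by
      refine ⟨?_, fun x => ⟨ιM x, hLι x, rfl⟩, ?_, ?_⟩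
      · rw [Submodule.map_coe]
        exact hMc.isClosedEmbedding_subtypeVal.isClosedMap _ hLc
      · rintro _ ⟨x, hx, rfl⟩
        exact ⟨NM x, hLN.1 x hx, rfl⟩
      · rintro _ ⟨x, hx, rfl⟩
        refine ⟨NM' x, ?_, rfl⟩
        rw [hadj]
        exact hLN.2 x hx
    rw [eq_top_iff]
    rintro x -
    obtain ⟨y, hy, hyx⟩ := Submodule.mem_sInf.1 x.2 _ hmem
    rwa [← Subtype.ext hyx]

end Reducing

/-! ### Lifts in the commutant, and properties passing from `E` to `E'`. -/

section Moreover

variable {H K : Type u} [NormedAddCommGroup H] [InnerProductSpace ℂ H] [CompleteSpace H]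
  [NormedAddCommGroup K] [InnerProductSpace ℂ K] [CompleteSpace K]
  {ι : H →ₗᵢ[ℂ] K} {S : H →L[ℂ] H} {N : K →L[ℂ] K}

theorem adjoint_isometry_apply (ι : H →ₗᵢ[ℂ] K) (x : H) :
    adjoint ι.toContinuousLinearMap (ι x) = x :=
  congrArg (fun T : H →L[ℂ] H => T x) ι.adjoint_comp_self

theorem inner_adjoint_isometry (ι : H →ₗᵢ[ℂ] K) (x : K) (y : H) :
    ⟪adjoint ι.toContinuousLinearMap x, y⟫_ℂ = ⟪x, ι y⟫_ℂ := by
  rw [adjoint_inner_left]; rfl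

theorem rangeProj_apply (ι : H →ₗᵢ[ℂ] K) (x : K) :
    rangeProj ι x = ι (adjoint ι.toContinuousLinearMap x) := by
  have : CompleteSpace (LinearMap.range ι.toLinearMap) :=
    (ι.isometry.isUniformInducing.isComplete_range).completeSpace_coe
  refine Submodule.eq_starProjection_of_mem_of_inner_eq_zero ⟨_, rfl⟩ ?_
  rintro _ ⟨y, rfl⟩
  change ⟪x - ι (adjoint ι.toContinuousLinearMap x), ι y⟫_ℂ = 0
  rw [← inner_adjoint_isometry, map_sub, adjoint_isometry_apply, sub_self, inner_zero_left]

theorem OpExtends.adjoint_isometry_apply_apply {A : H →L[ℂ] H} {B : K →L[ℂ] K}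
    (h : OpExtends ι A B) (hA : IsSelfAdjoint A) (hB : IsSelfAdjoint B) (x : K) :
    adjoint ι.toContinuousLinearMap (B x) = A (adjoint ι.toContinuousLinearMap x) := by
  refine ext_inner_right ℂ fun y => ?_
  have h1 : ⟪B x, ι y⟫_ℂ = ⟪x, B (ι y)⟫_ℂ := hB.isSymmetric _ _
  have h2 : ⟪A (adjoint ι.toContinuousLinearMap x), y⟫_ℂ =
    ⟪adjoint ι.toContinuousLinearMap x, A y⟫_ℂ := hA.isSymmetric _ _
  rw [inner_adjoint_isometry, h1, h2, inner_adjoint_isometry, h y]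

theorem IsOrbitLift.isLift (hm : IsMinimalNormalExtension ι S N) {A : H →L[ℂ] H}
    {B : K →L[ℂ] K} (hA : IsSelfAdjoint A) (hB : IsSelfAdjoint B) (hAS : Commute A S)
    (h : IsOrbitLift ι N A B) : IsLift ι S N A B where
  mne := hm
  mem_commutant := by
    rw [Set.mem_centralizer_iff]
    rintro T (rfl | rfl)
    · exact hAS.eq.symm
    · have := hAS.star_star
      rw [hA.star_eq] at this
      exact this.eq.symm
  mem := by
    refine ⟨?_, ?_⟩
    · rw [Set.mem_centralizer_iff]
      rintro T rfl
      have := (h.commute_star hm).star_star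
      rw [hB.star_eq, star_star] at this
      exact this.eq
    · rw [Set.mem_centralizer_iff]
      rintro T rfl
      ext x
      rw [mul_apply_eq_comp, mul_apply_eq_comp, rangeProj_apply, rangeProj_apply,
        h.opExtends.adjoint_isometry_apply_apply hA hB, h.opExtends]
  extend := h.opExtends
  unique := by
    rintro B' ⟨h1, h2⟩ hext
    have hN : N * B' = B' * N := Set.mem_centralizer_iff.1 h1 N rfl
    have hP : rangeProj ι * B' = B' * rangeProj ι := Set.mem_centralizer_iff.1 h2 _ rfl
    -- The orbit is built from `N*`, while `B'` is only known to commute with `N`. Passing to `star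
    -- B'` repairs this; it still extends the self-adjoint `A` because `B'` commutes with the
    -- projection onto `H`.
    have hstar : OpExtends ι A (star B') := fun x => by
      refine ext_inner_right ℂ fun y => ?_
      have h3 := congrArg (fun T : K →L[ℂ] K => T y) hP
      simp only [mul_apply_eq_comp, rangeProj_apply] at h3
      rw [← hext] at h3
      have h4 := ι.injective h3
      have h5 : ⟪A x, adjoint ι.toContinuousLinearMap y⟫_ℂ =
        ⟪x, A (adjoint ι.toContinuousLinearMap y)⟫_ℂ := hA.isSymmetric _ _
      rw [star_eq_adjoint, adjoint_inner_left, ← inner_conj_symm, ← inner_adjoint_isometry,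
        inner_conj_symm, h5, ← h4, ← inner_conj_symm, inner_adjoint_isometry, inner_conj_symm]
    have hc : Commute (star N) (star B') := Commute.star_star hN
    have := (hstar.isOrbitLift hc).unique hm h
    rw [← star_star B', this, hB.star_eq]

variable {H₁ K₁ : Type u} [NormedAddCommGroup H₁] [InnerProductSpace ℂ H₁] [CompleteSpace H₁]
  [NormedAddCommGroup K₁] [InnerProductSpace ℂ K₁] [CompleteSpace K₁]
  {ι₁ : H₁ →ₗᵢ[ℂ] K₁} {E : H →L[ℂ] H₁} {E' : K →L[ℂ] K₁}

omit [CompleteSpace H] [CompleteSpace K] in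
theorem OpExtends.commute {A : H →L[ℂ] H} {B : K →L[ℂ] K} (h : OpExtends ι A B)
    (hS : OpExtends ι S N) (hc : Commute B N) : Commute A S := by
  ext x
  apply ι.injective
  rw [h.mul hS x, hS.mul h x, hc.eq]

/-- For `T = N*ⁿ ι` the lift relation `|E'| T = T |E|` has adjoint `T* |E'| = |E| T*`. So `|E'| x =
0` forces `T* x = 0` for every `n`, and `x` is orthogonal to the whole orbit. -/
theorem IsOrbitLift.injective_of_injective (hm : IsMinimalNormalExtension ι S N)
    (h : IsOrbitLift ι N (modulus E) (modulus E')) (hE : Function.Injective E) :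
    Function.Injective E' := by
  rw [injective_iff_map_eq_zero] at hE ⊢
  intro x hx
  rw [← modulus_apply_eq_zero_iff] at hx
  refine hm.eq_zero_of_inner fun n y => ?_
  let T : H →L[ℂ] K := ((star N) ^ n) ∘L ι.toContinuousLinearMap
  have hT : adjoint T x = 0 := by
    refine hE _ ((modulus_apply_eq_zero_iff E _).1 (ext_inner_right ℂ fun z => ?_))
    have h1 : ⟪modulus E (adjoint T x), z⟫_ℂ = ⟪adjoint T x, modulus E z⟫_ℂ :=
      (modulus_isSelfAdjoint E).isSymmetric _ _
    have h2 : ⟪modulus E' x, T z⟫_ℂ = ⟪x, modulus E' (T z)⟫_ℂ :=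
      (modulus_isSelfAdjoint E').isSymmetric _ _
    have h3 : modulus E' (T z) = T (modulus E z) := h n z
    rw [h1, adjoint_inner_left, ← h3, ← h2, hx, inner_zero_left, inner_zero_left]
  change ⟪x, T y⟫_ℂ = 0
  rw [← adjoint_inner_left, hT, inner_zero_left]

/-- The inverse of `|E|` is self-adjoint and commutes with `S`, so it lifts to some `C` with `C |E'|
= 1`; then `C² E'*` is a left inverse of `E'`. -/
theorem IsOrbitLift.leftInvertible_of_leftInvertible (hm : IsMinimalNormalExtension ι S N)
    (h : IsOrbitLift ι N (modulus E) (modulus E')) (hS : Commute (modulus E) S)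
    (hE : LeftInvertible E) : LeftInvertible E' := by
  obtain ⟨u, hu⟩ := hE.isUnit_modulus
  have hinv : IsSelfAdjoint (↑u⁻¹ : H →L[ℂ] H) := by
    have h1 : star (u : H →L[ℂ] H) = u := by rw [hu]; exact modulus_isSelfAdjoint E
    have h2 : star u = u := Units.ext h1
    have h3 : star u⁻¹ = u⁻¹ := by rw [star_inv, h2]
    exact congrArg Units.val h3
  have hinvS : Commute (↑u⁻¹ : H →L[ℂ] H) S := by
    rw [← hu] at hS
    exact hS.units_inv_left
  obtain ⟨C, hC⟩ := hm.exists_isOrbitLift hinv hinvS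
  have hCE : C * modulus E' = 1 := by
    have := hC.mul h
    rw [← hu, Units.inv_mul] at this
    exact this.unique hm isOrbitLift_one
  refine ⟨(C * C) ∘L adjoint E', ?_⟩
  ext x
  have e : ∀ y, C (modulus E' y) = y := fun y => congrArg (fun T : K →L[ℂ] K => T y) hCE
  change C (C (adjoint E' (E' x))) = x
  rw [← modulus_apply_apply, e, e]

theorem IsOrbitLift.isometry_of_isometry (hm : IsMinimalNormalExtension ι S N)
    (h : IsOrbitLift ι N (modulus E) (modulus E')) (hE : Isometry E) : Isometry E' := by
  have h1 : modulus E = 1 := modulus_eq_of_norm_eq zero_le_one fun x => by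
    rw [(AddMonoidHomClass.isometry_iff_norm E).1 hE x]; rfl
  rw [h1] at h
  have h2 := h.unique hm isOrbitLift_one
  refine (AddMonoidHomClass.isometry_iff_norm E').2 fun x => ?_
  rw [← norm_modulus, h2]; rfl

end Moreover

/-! ### The auxiliary space `L` and the dimension count. -/

section Construction

variable {H₁ H₂ K₂ : Type u}
  [NormedAddCommGroup H₁] [InnerProductSpace ℂ H₁] [CompleteSpace H₁]
  [NormedAddCommGroup H₂] [InnerProductSpace ℂ H₂] [CompleteSpace H₂]
  [NormedAddCommGroup K₂] [InnerProductSpace ℂ K₂] [CompleteSpace K₂]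
  {ι : H₂ →ₗᵢ[ℂ] K₂} {V : H₁ →L[ℂ] H₁} {E : H₂ →L[ℂ] H₁} {S : H₂ →L[ℂ] H₂}
  {N : K₂ →L[ℂ] K₂} {B : K₂ →L[ℂ] K₂} {D : Submodule ℂ H₁}

/-- The compression of `x` to the orthogonal complement of the range of `ι`, followed by `B`. -/
noncomputable def offRange (ι : H₂ →ₗᵢ[ℂ] K₂) (B : K₂ →L[ℂ] K₂) : K₂ →L[ℂ] K₂ :=
  B ∘L (ContinuousLinearMap.id ℂ K₂ -
    ι.toContinuousLinearMap ∘L adjoint ι.toContinuousLinearMap)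

/-- The closure of the range of `offRange ι B`. -/
noncomputable def offRangeClosure (ι : H₂ →ₗᵢ[ℂ] K₂) (B : K₂ →L[ℂ] K₂) : Submodule ℂ K₂ :=
  (LinearMap.range (offRange ι B).toLinearMap).topologicalClosure

instance : CompleteSpace (offRangeClosure ι B) :=
  (Submodule.isClosed_topologicalClosure _).completeSpace_coe

/-- The canonical isometric embedding of `X` into `X ⊕ Y`. -/
noncomputable def inlLI (X Y : Type u) [NormedAddCommGroup X] [InnerProductSpace ℂ X]
    [NormedAddCommGroup Y] [InnerProductSpace ℂ Y] : X →ₗᵢ[ℂ] HSum X Y :=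
  { toLinearMap := (inlL X Y).toLinearMap
    norm_map' := fun x => by simp [inlL] }

/-- The canonical isometric embedding of `Y` into `X ⊕ Y`. -/
noncomputable def inrLI (X Y : Type u) [NormedAddCommGroup X] [InnerProductSpace ℂ X]
    [NormedAddCommGroup Y] [InnerProductSpace ℂ Y] : Y →ₗᵢ[ℂ] HSum X Y :=
  { toLinearMap := (inrL X Y).toLinearMap
    norm_map' := fun x => by simp [inrL] }

theorem inner_inlLI_left {X Y : Type u} [NormedAddCommGroup X] [InnerProductSpace ℂ X]
    [NormedAddCommGroup Y] [InnerProductSpace ℂ Y] (x : X) (z : HSum X Y) :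
    ⟪inlLI X Y x, z⟫_ℂ = ⟪x, z.fst⟫_ℂ := by
  simp [inlLI, inlL, WithLp.prod_inner_apply]

theorem inner_inrLI_left {X Y : Type u} [NormedAddCommGroup X] [InnerProductSpace ℂ X]
    [NormedAddCommGroup Y] [InnerProductSpace ℂ Y] (y : Y) (z : HSum X Y) :
    ⟪inrLI X Y y, z⟫_ℂ = ⟪y, z.snd⟫_ℂ := by
  simp [inrLI, inrL, WithLp.prod_inner_apply]

@[simp] theorem inlLI_fst {X Y : Type u} [NormedAddCommGroup X] [InnerProductSpace ℂ X]
    [NormedAddCommGroup Y] [InnerProductSpace ℂ Y] (x : X) : (inlLI X Y x).fst = x := by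
  simp [inlLI, inlL]

@[simp] theorem inlLI_snd {X Y : Type u} [NormedAddCommGroup X] [InnerProductSpace ℂ X]
    [NormedAddCommGroup Y] [InnerProductSpace ℂ Y] (x : X) : (inlLI X Y x).snd = 0 := by
  simp [inlLI, inlL]

@[simp] theorem inrLI_fst {X Y : Type u} [NormedAddCommGroup X] [InnerProductSpace ℂ X]
    [NormedAddCommGroup Y] [InnerProductSpace ℂ Y] (y : Y) : (inrLI X Y y).fst = 0 := by
  simp [inrLI, inrL]

@[simp] theorem inrLI_snd {X Y : Type u} [NormedAddCommGroup X] [InnerProductSpace ℂ X]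
    [NormedAddCommGroup Y] [InnerProductSpace ℂ Y] (y : Y) : (inrLI X Y y).snd = y := by
  simp [inrLI, inrL]

/-- The orthogonal complement in `H₁ ⊕ L` of `ran V + ran E + D`. -/
noncomputable def freePart (V : H₁ →L[ℂ] H₁) (E : H₂ →L[ℂ] H₁) (D : Submodule ℂ H₁) (L : Type u)
    [NormedAddCommGroup L] [InnerProductSpace ℂ L] : Submodule ℂ (HSum H₁ L) :=
  ((LinearMap.range V.toLinearMap ⊔ LinearMap.range E.toLinearMap ⊔ D).map
    (inlLI H₁ L).toLinearMap)ᗮ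

omit [CompleteSpace H₁] [CompleteSpace H₂] in
theorem mem_freePart {L : Type u} [NormedAddCommGroup L] [InnerProductSpace ℂ L]
    {w : HSum H₁ L} : w ∈ freePart V E D L ↔
      (∀ h, ⟪V h, w.fst⟫_ℂ = 0) ∧ (∀ h, ⟪E h, w.fst⟫_ℂ = 0) ∧ ∀ d ∈ D, ⟪d, w.fst⟫_ℂ = 0 := by
  rw [freePart, Submodule.map_sup, Submodule.map_sup, ← Submodule.inf_orthogonal,
    ← Submodule.inf_orthogonal, Submodule.mem_inf, Submodule.mem_inf, and_assoc]
  simp only [Submodule.mem_orthogonal, Submodule.mem_map, LinearMap.mem_range]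
  refine and_congr ?_ (and_congr ?_ ?_)
  · constructor
    · intro h x
      rw [← inner_inlLI_left]
      exact h _ ⟨V x, ⟨x, rfl⟩, rfl⟩
    · rintro h _ ⟨_, ⟨x, rfl⟩, rfl⟩
      exact (inner_inlLI_left _ _).trans (h x)
  · constructor
    · intro h x
      rw [← inner_inlLI_left]
      exact h _ ⟨E x, ⟨x, rfl⟩, rfl⟩
    · rintro h _ ⟨_, ⟨x, rfl⟩, rfl⟩
      exact (inner_inlLI_left _ _).trans (h x)
  · constructor
    · intro h d hd
      rw [← inner_inlLI_left]
      exact h _ ⟨d, hd, rfl⟩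
    · rintro h _ ⟨d, hd, rfl⟩
      exact (inner_inlLI_left _ _).trans (h d hd)

instance {L : Type u} [NormedAddCommGroup L] [InnerProductSpace ℂ L] [CompleteSpace L] :
    CompleteSpace (freePart V E D L) :=
  (Submodule.isClosed_orthogonal _).completeSpace_coe

/-- Orthogonality to all `N*ⁿ E* y` puts `x` in the kernel of `B`, while `x` lies in the closure of
`ran B`; these are orthogonal. Hence the projections of the `N*ⁿ E* y` are total in `offRangeClosure
ι B`, which bounds its dimension through `H₁`. -/
theorem eq_zero_of_mem_offRangeClosure (hm : IsMinimalNormalExtension ι S N)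
    (hBs : IsSelfAdjoint B) (hB : IsOrbitLift ι N (modulus E) B) {x : K₂}
    (hx : x ∈ offRangeClosure ι B)
    (h : ∀ n y, ⟪x, ((star N) ^ n) (ι (adjoint E y))⟫_ℂ = 0) : x = 0 := by
  have hBx : B x = 0 := by
    refine hm.eq_zero_of_inner fun n y => ?_
    let T : H₂ →L[ℂ] K₂ := ((star N) ^ n) ∘L ι.toContinuousLinearMap
    have hT : E (adjoint T x) = 0 := by
      refine ext_inner_right ℂ fun z => ?_
      rw [← adjoint_inner_right, adjoint_inner_left, inner_zero_left]
      exact h n z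
    have h1 : ⟪B x, T y⟫_ℂ = ⟪x, B (T y)⟫_ℂ := hBs.isSymmetric _ _
    have h2 : ⟪modulus E (adjoint T x), y⟫_ℂ = ⟪adjoint T x, modulus E y⟫_ℂ :=
      (modulus_isSelfAdjoint E).isSymmetric _ _
    have h3 : B (T y) = T (modulus E y) := hB n y
    change ⟪B x, T y⟫_ℂ = 0
    rw [h1, h3, ← adjoint_inner_left, ← h2, (modulus_apply_eq_zero_iff E _).2 hT,
      inner_zero_left]
  have hperp : x ∈ (offRangeClosure ι B)ᗮ := by
    rw [offRangeClosure, Submodule.orthogonal_closure, Submodule.mem_orthogonal']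
    rintro _ ⟨y, rfl⟩
    have h1 : ∀ z, ⟪x, B z⟫_ℂ = ⟪B x, z⟫_ℂ := fun z => (hBs.isSymmetric _ _).symm
    exact (h1 _).trans (by rw [hBx, inner_zero_left])
  exact inner_self_eq_zero.1 (Submodule.inner_left_of_mem_orthogonal hx hperp)

theorem hilbertDim_offRangeClosure_le (hm : IsMinimalNormalExtension ι S N)
    (hBs : IsSelfAdjoint B) (hB : IsOrbitLift ι N (modulus E) B)
    (hH : ¬ FiniteDimensional ℂ H₁) :
    hilbertDim (offRangeClosure ι B) ≤ hilbertDim H₁ := by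
  have hinf := aleph0_le_hilbertDim hH
  obtain ⟨α, ⟨b⟩⟩ := exists_hilbertBasis_type H₁
  rw [hilbertDim_eq_mk b] at hinf ⊢
  refine (hilbertDim_le_of_family (fun p : ℕ × α =>
    (offRangeClosure ι B).orthogonalProjectionOnto
      (((star N) ^ p.1) (ι (adjoint E (b p.2))))) fun x hx => ?_).trans ?_
  · refine Subtype.ext (eq_zero_of_mem_offRangeClosure hm hBs hB x.2 fun n y => ?_)
    let T : H₁ →L[ℂ] K₂ := ((star N) ^ n) ∘L ι.toContinuousLinearMap ∘L adjoint E
    have hT : adjoint T (x : K₂) = 0 := by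
      by_contra hne
      obtain ⟨a, ha⟩ := hilbertBasis_exists_inner_ne_zero b hne
      rw [adjoint_inner_left] at ha
      have := hx (n, a)
      rw [Submodule.inner_orthogonalProjectionOnto_eq_of_mem_left] at this
      exact ha this
    change ⟪(x : K₂), T y⟫_ℂ = 0
    rw [← adjoint_inner_left, hT, inner_zero_left]
  · simp [Cardinal.aleph0_mul_eq hinf, Cardinal.mul_aleph0_eq hinf]

/-- In finite dimension the isometry `V` is onto, which forces `E = 0`, and every space in sight is
zero with `L = 0`. In infinite dimension `L = H₁` is large enough to absorb `offRangeClosure ι B` by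
cardinal arithmetic. -/
theorem exists_complement (hm : IsMinimalNormalExtension ι S N)
    (hBs : IsSelfAdjoint B) (hB : IsOrbitLift ι N (modulus E) B)
    (hV : ∀ x, ‖V x‖ = ‖x‖) (hVE : ∀ x y, ⟪V x, E y⟫_ℂ = 0) :
    ∃ (L : Type u) (_ : NormedAddCommGroup L) (_ : InnerProductSpace ℂ L) (_ : CompleteSpace L),
      hilbertDim (HSum H₁ L) = hilbertDim H₁ ∧
      Nonempty (HSum L (offRangeClosure ι B) ≃ₗᵢ[ℂ] freePart V E D L) := by
  by_cases hH : FiniteDimensional ℂ H₁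
  · have hinj : Function.Injective V := by
      rw [injective_iff_map_eq_zero]
      intro x hx
      rw [← norm_eq_zero, ← hV, hx, norm_zero]
    have hsurj : Function.Surjective V := LinearMap.injective_iff_surjective.1 hinj
    have hE : E = 0 := by
      ext y
      obtain ⟨x, hx⟩ := hsurj (E y)
      have := hVE x y
      rw [hx] at this
      exact inner_self_eq_zero.1 this
    let L := (⊥ : Submodule ℂ H₁)
    have hsM : Subsingleton (offRangeClosure ι B) := by
      refine subsingleton_of_forall_eq 0 fun x => Subtype.ext ?_
      refine eq_zero_of_mem_offRangeClosure hm hBs hB x.2 fun n y => ?_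
      simp [hE]
    have hsW : Subsingleton (freePart V E D L) := by
      refine subsingleton_of_forall_eq 0 fun w => Subtype.ext ?_
      have h1 : (w : HSum H₁ L).fst = 0 := by
        obtain ⟨x, hx⟩ := hsurj (w : HSum H₁ L).fst
        have := (mem_freePart.1 w.2).1 x
        rw [hx] at this
        exact inner_self_eq_zero.1 this
      exact WithLp.ofLp_injective 2 (Prod.ext h1 (Subsingleton.elim _ _))
    refine ⟨L, inferInstance, inferInstance, inferInstance, ?_, ?_⟩
    · rw [hilbertDim_prod, hilbertDim_eq_zero (X := L), add_zero]
    · refine nonempty_linearIsometryEquiv (X := HSum L (offRangeClosure ι B))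
        (Y := freePart V E D L) ?_
      rw [hilbertDim_prod, hilbertDim_eq_zero (X := L), hilbertDim_eq_zero, hilbertDim_eq_zero,
        add_zero]
  · have hinf := aleph0_le_hilbertDim hH
    have hsum : hilbertDim (HSum H₁ H₁) = hilbertDim H₁ := by
      rw [hilbertDim_prod, Cardinal.add_eq_self hinf]
    refine ⟨H₁, inferInstance, inferInstance, inferInstance, hsum, ?_⟩
    refine nonempty_linearIsometryEquiv (X := HSum H₁ (offRangeClosure ι B))
      (Y := freePart V E D H₁) ?_
    have hK : ¬ FiniteDimensional ℂ (HSum H₁ H₁) := fun h =>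
      hH (FiniteDimensional.of_injective (inlLI H₁ H₁).toLinearMap (inlLI H₁ H₁).injective)
    let j : H₁ →ₗᵢ[ℂ] freePart V E D H₁ :=
      { toLinearMap := (inrLI H₁ H₁).toLinearMap.codRestrict _ fun x =>
          mem_freePart.2 ⟨fun h => by simp, fun h => by simp, fun d _ => by simp⟩
        norm_map' := fun x => (inrLI H₁ H₁).norm_map x }
    have hW : ¬ FiniteDimensional ℂ (freePart V E D H₁) := fun h =>
      hH (FiniteDimensional.of_injective j.toLinearMap j.injective)
    rw [hilbertDim_prod, Cardinal.add_eq_left hinf (hilbertDim_offRangeClosure_le hm hBs hB hH)]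
    -- The free part contains the summand `L = H₁` and sits inside `H₁ ⊕ H₁`, so its dimension is
    -- squeezed.
    refine le_antisymm (hilbertDim_le_of_isometry j hW) ?_
    rw [← hsum]
    exact hilbertDim_le_of_isometry (freePart V E D H₁).subtypeₗᵢ hK

end Construction

/-! ### Construction of `V'` and `E'`. -/

section Extension

variable {H₁ H₂ K₂ : Type u}
  [NormedAddCommGroup H₁] [InnerProductSpace ℂ H₁] [CompleteSpace H₁]
  [NormedAddCommGroup H₂] [InnerProductSpace ℂ H₂] [CompleteSpace H₂]
  [NormedAddCommGroup K₂] [InnerProductSpace ℂ K₂] [CompleteSpace K₂]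
  {ι : H₂ →ₗᵢ[ℂ] K₂} {V : H₁ →L[ℂ] H₁} {E : H₂ →L[ℂ] H₁} {S : H₂ →L[ℂ] H₂}
  {N : K₂ →L[ℂ] K₂} {B : K₂ →L[ℂ] K₂} {D : Submodule ℂ H₁}

omit [CompleteSpace K₂] in
theorem mem_orthogonal_range_sup_closure {K₁ : Type u} [NormedAddCommGroup K₁]
    [InnerProductSpace ℂ K₁] {V : K₁ →L[ℂ] K₁} {E : K₂ →L[ℂ] K₁} {x : K₁} :
    x ∈ (LinearMap.range V.toLinearMap ⊔
      (LinearMap.range E.toLinearMap).topologicalClosure)ᗮ ↔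
      (∀ y, ⟪V y, x⟫_ℂ = 0) ∧ ∀ y, ⟪E y, x⟫_ℂ = 0 := by
  rw [← Submodule.inf_orthogonal, Submodule.orthogonal_closure, Submodule.mem_inf]
  simp [Submodule.mem_orthogonal]

/-- Being self-adjoint, `B` preserves both the range of `ι` and its orthogonal complement, so
Pythagoras applies to the two parts of `B k`. -/
theorem norm_sq_of_isOrbitLift (hBs : IsSelfAdjoint B) (hB : OpExtends ι (modulus E) B)
    (k : K₂) :
    ‖B k‖ ^ 2 = ‖E (adjoint ι.toContinuousLinearMap k)‖ ^ 2 + ‖offRange ι B k‖ ^ 2 := by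
  set y := adjoint ι.toContinuousLinearMap k with hy
  have hG : offRange ι B k = B (k - ι y) := rfl
  have h1 : B k = ι (modulus E y) + offRange ι B k := by
    rw [hG, hB y, map_sub, add_sub_cancel]
  have h2 : ⟪ι (modulus E y), offRange ι B k⟫_ℂ = 0 := by
    rw [← inner_conj_symm, ← inner_adjoint_isometry, hG,
      hB.adjoint_isometry_apply_apply (modulus_isSelfAdjoint E) hBs, map_sub,
      adjoint_isometry_apply, ← hy, sub_self, map_zero, inner_zero_left, map_zero]
  have h3 := norm_add_sq_eq_norm_sq_add_norm_sq_of_inner_eq_zero _ _ h2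
  rw [← h1, ι.norm_map, norm_modulus] at h3
  rw [sq, sq, sq, h3]

theorem exists_extension (hm : IsMinimalNormalExtension ι S N)
    (hB0 : 0 ≤ B) (hB : IsOrbitLift ι N (modulus E) B)
    (hV : ∀ x, ‖V x‖ = ‖x‖) (hVE : ∀ x y, ⟪V x, E y⟫_ℂ = 0)
    (hDc : IsClosed (D : Set H₁)) (hVD : ∀ x, ∀ d ∈ D, ⟪V x, d⟫_ℂ = 0)
    (hED : ∀ x, ∀ d ∈ D, ⟪E x, d⟫_ℂ = 0) :
    ∃ (K₁ : Type u) (_ : NormedAddCommGroup K₁) (_ : InnerProductSpace ℂ K₁)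
      (_ : CompleteSpace K₁) (ι₁ : H₁ →ₗᵢ[ℂ] K₁) (V' : K₁ →L[ℂ] K₁) (E' : K₂ →L[ℂ] K₁),
      (∀ x, ‖V' x‖ = ‖x‖) ∧ (∀ x y, ⟪V' x, E' y⟫_ℂ = 0) ∧ (∀ x, ι₁ (V x) = V' (ι₁ x)) ∧
      (∀ x, ι₁ (E x) = E' (ι x)) ∧ modulus E' = B ∧ hilbertDim K₁ = hilbertDim H₁ ∧
      D.map ι₁.toLinearMap = (LinearMap.range V'.toLinearMap ⊔
        (LinearMap.range E'.toLinearMap).topologicalClosure)ᗮ := by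
  have hBs : IsSelfAdjoint B := IsSelfAdjoint.of_nonneg hB0
  obtain ⟨L, _, _, _, hdim, ⟨U⟩⟩ := exists_complement (D := D) hm hBs hB hV hVE
  let M := offRangeClosure ι B
  let W := freePart V E D L
  let i := inlLI H₁ L
  -- The unitary `U` splits the free part `W` into orthogonal copies of `L` and `M`: `p` carries
  -- `V'` on the new summand, and `q` carries the part of `E'` that lives off the range of `ι`.
  let p : L →ₗᵢ[ℂ] HSum H₁ L := W.subtypeₗᵢ.comp (U.toLinearIsometry.comp (inlLI L M))
  let q : M →ₗᵢ[ℂ] HSum H₁ L := W.subtypeₗᵢ.comp (U.toLinearIsometry.comp (inrLI L M))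
  let G : K₂ →L[ℂ] M := (offRange ι B).codRestrict M fun x =>
    Submodule.le_topologicalClosure _ ⟨x, rfl⟩
  let J := ι.toContinuousLinearMap
  have hpW : ∀ l, p l ∈ W := fun l => (U (inlLI L M l)).2
  have hqW : ∀ m, q m ∈ W := fun m => (U (inrLI L M m)).2
  have hpq : ∀ l m, ⟪p l, q m⟫_ℂ = 0 := fun l m => by
    have h1 : ⟪p l, q m⟫_ℂ = ⟪inlLI L M l, inrLI L M m⟫_ℂ := U.inner_map_map _ _
    rw [h1, inner_inlLI_left, inrLI_fst, inner_zero_right]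
  have hspan : ∀ w ∈ W, (∀ l, ⟪p l, w⟫_ℂ = 0) → (∀ m, ⟪q m, w⟫_ℂ = 0) → w = 0 := by
    intro w hw h1 h2
    obtain ⟨z, hz⟩ := U.surjective ⟨w, hw⟩
    have e1 : z.fst = 0 := by
      refine (inner_self_eq_zero (𝕜 := ℂ)).1 ?_
      rw [← inner_inlLI_left, ← U.inner_map_map, hz]
      exact h1 _
    have e2 : z.snd = 0 := by
      refine (inner_self_eq_zero (𝕜 := ℂ)).1 ?_
      rw [← inner_inrLI_left, ← U.inner_map_map, hz]
      exact h2 _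
    have e3 : z = 0 := WithLp.ofLp_injective 2 (Prod.ext e1 e2)
    rw [e3, map_zero] at hz
    exact (congrArg Subtype.val hz).symm
  have hiW : ∀ x y, ⟪i x, y⟫_ℂ = ⟪x, y.fst⟫_ℂ := fun x y => inner_inlLI_left x y
  have hVW : ∀ x, ∀ w ∈ W, ⟪i (V x), w⟫_ℂ = 0 := fun x w hw =>
    (hiW _ _).trans ((mem_freePart.1 hw).1 x)
  have hEW : ∀ x, ∀ w ∈ W, ⟪i (E x), w⟫_ℂ = 0 := fun x w hw =>
    (hiW _ _).trans ((mem_freePart.1 hw).2.1 x)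
  have hDW : ∀ d ∈ D, ∀ w ∈ W, ⟪w, i d⟫_ℂ = 0 := fun d hd w hw =>
    inner_eq_zero_symm.1 ((hiW _ _).trans ((mem_freePart.1 hw).2.2 d hd))
  let V' : HSum H₁ L →L[ℂ] HSum H₁ L :=
    i.toContinuousLinearMap ∘L V ∘L WithLp.fstL 2 ℂ H₁ L +
      p.toContinuousLinearMap ∘L WithLp.sndL 2 ℂ H₁ L
  let E' : K₂ →L[ℂ] HSum H₁ L :=
    i.toContinuousLinearMap ∘L E ∘L adjoint J + q.toContinuousLinearMap ∘L G
  have hV'a : ∀ x, V' x = i (V x.fst) + p x.snd := fun x => rfl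
  have hE'a : ∀ k, E' k = i (E (adjoint J k)) + q (G k) := fun k => rfl
  have hV'i : ∀ x, V' (i x) = i (V x) := fun x => by
    rw [hV'a, inlLI_fst, inlLI_snd, map_zero, add_zero]
  have hGι : ∀ y, G (ι y) = 0 := fun y => by
    refine Subtype.ext ?_
    change B (ι y - ι (adjoint J (ι y))) = 0
    rw [adjoint_isometry_apply, sub_self, map_zero]
  have hE'ι : ∀ y, E' (ι y) = i (E y) := fun y => by
    rw [hE'a, hGι, map_zero, add_zero, adjoint_isometry_apply]
  refine ⟨HSum H₁ L, inferInstance, inferInstance, inferInstance, i, V', E', ?_, ?_,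
    fun x => (hV'i x).symm, fun x => (hE'ι x).symm, ?_, hdim, ?_⟩
  · intro x
    have h1 := norm_add_sq_eq_norm_sq_add_norm_sq_of_inner_eq_zero _ _
      (hVW x.fst _ (hpW x.snd))
    rw [← hV'a, i.norm_map, p.norm_map, hV] at h1
    have h2 := WithLp.prod_norm_sq_eq_of_L2 x
    refine (sq_eq_sq₀ (norm_nonneg _) (norm_nonneg _)).1 ?_
    rw [h2, sq, sq, sq, h1]
  · intro x y
    rw [hV'a, hE'a, inner_add_left, inner_add_right, inner_add_right, i.inner_map_map, hVE,
      hVW _ _ (hqW _), inner_eq_zero_symm.1 (hEW _ _ (hpW _)), hpq]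
    simp
  · refine modulus_eq_of_norm_eq hB0 fun k => ?_
    have h1 := norm_add_sq_eq_norm_sq_add_norm_sq_of_inner_eq_zero _ _
      (hEW (adjoint J k) _ (hqW (G k)))
    rw [← hE'a, i.norm_map, q.norm_map] at h1
    have h2 := norm_sq_of_isOrbitLift hBs hB.opExtends k
    refine (sq_eq_sq₀ (norm_nonneg _) (norm_nonneg _)).1 ?_
    rw [h2, sq, sq, sq, h1]
    rfl
  · ext x
    rw [mem_orthogonal_range_sup_closure]
    constructor
    · rintro ⟨d, hd, rfl⟩
      change (∀ y, ⟪V' y, i d⟫_ℂ = 0) ∧ ∀ y, ⟪E' y, i d⟫_ℂ = 0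
      refine ⟨fun y => ?_, fun y => ?_⟩
      · rw [hV'a, inner_add_left, i.inner_map_map, hVD _ d hd, hDW d hd _ (hpW _), add_zero]
      · rw [hE'a, inner_add_left, i.inner_map_map, hED _ d hd, hDW d hd _ (hqW _), add_zero]
    · rintro ⟨h1, h2⟩
      have : CompleteSpace D := hDc.completeSpace_coe
      -- Subtracting the `D`-component puts `x` into `W`. There `x - i d` is orthogonal to the
      -- ranges of `p` and `q`, which fill `W`, so it is zero.
      let d : H₁ := D.starProjection x.fst
      have hd : d ∈ D := Submodule.starProjection_apply_mem D x.fst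
      have hfst : (x - i d).fst = x.fst - d := by
        change x.fst - (i d).fst = _
        rw [inlLI_fst]
      have hxW : x - i d ∈ W := by
        refine mem_freePart.2 ⟨fun h => ?_, fun h => ?_, fun e he => ?_⟩
        · have := h1 (i h)
          rw [hV'i, hiW] at this
          rw [hfst, inner_sub_right, this, hVD h d hd, sub_zero]
        · have := h2 (ι h)
          rw [hE'ι, hiW] at this
          rw [hfst, inner_sub_right, this, hED h d hd, sub_zero]
        · rw [hfst]
          exact Submodule.inner_right_of_mem_orthogonal he
            (Submodule.sub_starProjection_mem_orthogonal x.fst)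
      have hqG : ∀ k, ⟪q (G k), x - i d⟫_ℂ = 0 := fun k => by
        have h3 : q (G k) = E' k - E' (ι (adjoint J k)) := by
          rw [hE'ι, hE'a, add_sub_cancel_left]
        rw [inner_sub_right, hDW d hd _ (hqW _), h3, inner_sub_left, h2, h2, sub_zero, sub_zero]
      have hq0 : adjoint q.toContinuousLinearMap (x - i d) = 0 := by
        set z := adjoint q.toContinuousLinearMap (x - i d)
        have hz : (z : K₂) ∈ (M)ᗮ := by
          change (z : K₂) ∈ (offRangeClosure ι B)ᗮ
          rw [offRangeClosure, Submodule.orthogonal_closure, Submodule.mem_orthogonal']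
          rintro _ ⟨k, rfl⟩
          change ⟪z, G k⟫_ℂ = 0
          rw [inner_adjoint_isometry]
          exact inner_eq_zero_symm.1 (hqG k)
        exact Subtype.ext
          (inner_self_eq_zero.1 (Submodule.inner_left_of_mem_orthogonal z.2 hz))
      have h0 : x - i d = 0 := by
        refine hspan _ hxW (fun l => ?_) fun m => ?_
        · have h3 : V' (inrLI H₁ L l) = p l := by
            rw [hV'a, inrLI_fst, inrLI_snd, map_zero, map_zero, zero_add]
          rw [inner_sub_right, hDW d hd _ (hpW _), ← h3, h1, sub_zero]
        · rw [inner_eq_zero_symm, ← inner_adjoint_isometry, hq0, inner_zero_left]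
      exact ⟨d, hd, (sub_eq_zero.1 h0).symm⟩

end Extension

/-! ### The block conditions in terms of entries. -/

section Classes

variable {H₁ H₂ K₁ K₂ : Type u}
  [NormedAddCommGroup H₁] [InnerProductSpace ℂ H₁] [CompleteSpace H₁]
  [NormedAddCommGroup H₂] [InnerProductSpace ℂ H₂] [CompleteSpace H₂]
  [NormedAddCommGroup K₁] [InnerProductSpace ℂ K₁] [CompleteSpace K₁]
  [NormedAddCommGroup K₂] [InnerProductSpace ℂ K₂] [CompleteSpace K₂]
  {V : H₁ →L[ℂ] H₁} {E : H₂ →L[ℂ] H₁} {S : H₂ →L[ℂ] H₂}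

omit [CompleteSpace H₂] in
theorem adjoint_comp_eq_zero_iff : adjoint V ∘L E = 0 ↔ ∀ x y, ⟪V x, E y⟫_ℂ = 0 := by
  constructor
  · intro h x y
    have h1 : adjoint V (E y) = 0 := congrArg (fun T => T y) h
    rw [← adjoint_inner_right, h1, inner_zero_right]
  · intro h
    ext y
    refine ext_inner_left ℂ fun x => ?_
    rw [comp_apply, adjoint_inner_right, h, zero_apply, inner_zero_right]

theorem isBrownianTypeOfClass_blockOp_iff [Nontrivial H₁] [Nontrivial H₂]
    {P : (H₂ →L[ℂ] H₂) → Prop} :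
    IsBrownianTypeOfClass P (blockOp V E 0 S) ↔
      (∀ x, ‖V x‖ = ‖x‖) ∧ (∀ x y, ⟪V x, E y⟫_ℂ = 0) ∧ Commute (modulus E) S ∧ P S := by
  have hcomm : S ∘L (adjoint E ∘L E) = (adjoint E ∘L E) ∘L S ↔ Commute (modulus E) S := by
    refine ⟨commute_modulus, fun h => ?_⟩
    have := h.mul_left h
    rw [modulus_mul_self] at this
    exact this.eq.symm
  have hiso : adjoint V ∘L V = ContinuousLinearMap.id ℂ H₁ ↔ ∀ x, ‖V x‖ = ‖x‖ :=
    (norm_map_iff_adjoint_comp_self V).symm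
  constructor
  · intro h
    have h1 := h.isometric
    have h2 := h.orthogonal
    have h3 := h.commute
    have h4 := h.entry22_mem
    simp only [entry11_blockOp, entry12_blockOp, entry22_blockOp] at h1 h2 h3 h4
    exact ⟨hiso.1 h1, adjoint_comp_eq_zero_iff.1 h2, hcomm.1 h3, h4⟩
  · rintro ⟨h1, h2, h3, h4⟩
    refine ⟨inferInstance, inferInstance, ?_, ?_, ?_, ?_, ?_⟩ <;>
      simp only [entry11_blockOp, entry12_blockOp, entry21_blockOp, entry22_blockOp]
    · exact hiso.2 h1
    · exact adjoint_comp_eq_zero_iff.2 h2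
    · exact hcomm.2 h3
    · exact h4

omit [CompleteSpace H₁] [CompleteSpace H₂] [CompleteSpace K₁] [CompleteSpace K₂] in
theorem entrywiseExtends_blockOp_iff {ι₁ : H₁ →ₗᵢ[ℂ] K₁} {ι₂ : H₂ →ₗᵢ[ℂ] K₂}
    {V' : K₁ →L[ℂ] K₁} {E' : K₂ →L[ℂ] K₁} {N : K₂ →L[ℂ] K₂} :
    EntrywiseExtends ι₁ ι₂ (blockOp V E 0 S) (blockOp V' E' 0 N) ↔
      OpExtends ι₁ V V' ∧ (∀ x, ι₁ (E x) = E' (ι₂ x)) ∧ OpExtends ι₂ S N := by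
  constructor
  · intro h
    have h1 := h.ext11
    have h2 := h.ext12
    have h3 := h.ext22
    simp only [entry11_blockOp, entry12_blockOp, entry22_blockOp] at h1 h2 h3
    exact ⟨h1, h2, h3⟩
  · rintro ⟨h1, h2, h3⟩
    refine ⟨?_, ?_, ?_, ?_⟩ <;>
      simp only [entry11_blockOp, entry12_blockOp, entry21_blockOp, entry22_blockOp]
    · exact h1
    · exact h2
    · simp
    · exact h3

end Classes

end BrownianType

/-! ### The main theorem. -/

open BrownianType in
theorem theorem1p4 {H₁ H₂ : Type u}
    [NormedAddCommGroup H₁] [InnerProductSpace ℂ H₁] [CompleteSpace H₁] [Nontrivial H₁]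
    [NormedAddCommGroup H₂] [InnerProductSpace ℂ H₂] [CompleteSpace H₂] [Nontrivial H₂]
    (V : H₁ →L[ℂ] H₁) (E : H₂ →L[ℂ] H₁) (S : H₂ →L[ℂ] H₂)
    (D : Submodule ℂ H₁) (hDclosed : IsClosed (D : Set H₁))
    (hD : D ≤ (LinearMap.range V.toLinearMap ⊔
      (LinearMap.range E.toLinearMap).topologicalClosure)ᗮ) :
    List.TFAE [
      -- (i)
      ClassS (blockOp V E 0 S),
      -- (ii)
      ∃ (K₁ : Type u) (_ : NormedAddCommGroup K₁) (_ : InnerProductSpace ℂ K₁)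
        (_ : CompleteSpace K₁)
        (K₂ : Type u) (_ : NormedAddCommGroup K₂) (_ : InnerProductSpace ℂ K₂)
        (_ : CompleteSpace K₂)
        (ι₁ : H₁ →ₗᵢ[ℂ] K₁) (ι₂ : H₂ →ₗᵢ[ℂ] K₂)
        (V' : K₁ →L[ℂ] K₁) (E' : K₂ →L[ℂ] K₁) (N : K₂ →L[ℂ] K₂),
        ClassN (blockOp V' E' 0 N) ∧
        EntrywiseExtends ι₁ ι₂ (blockOp V E 0 S) (blockOp V' E' 0 N) ∧
        OpExtends ι₂ (modulus E) (modulus E'),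
      -- (iii)
      IsSubnormal S ∧
      ∀ (K₂ : Type u) [NormedAddCommGroup K₂] [InnerProductSpace ℂ K₂] [CompleteSpace K₂]
        (ι₂ : H₂ →ₗᵢ[ℂ] K₂) (N : K₂ →L[ℂ] K₂), IsMinimalNormalExtension ι₂ S N →
        ∃ (K₁ : Type u) (_ : NormedAddCommGroup K₁) (_ : InnerProductSpace ℂ K₁)
          (_ : CompleteSpace K₁)
          (ι₁ : H₁ →ₗᵢ[ℂ] K₁) (V' : K₁ →L[ℂ] K₁) (E' : K₂ →L[ℂ] K₁),
          ClassN (blockOp V' E' 0 N) ∧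
          EntrywiseExtends ι₁ ι₂ (blockOp V E 0 S) (blockOp V' E' 0 N) ∧
          OpExtends ι₂ (modulus E) (modulus E') ∧
          hilbertDim K₁ = hilbertDim H₁ ∧
          hilbertDim K₂ = hilbertDim H₂ ∧
          D.map ι₁.toLinearMap = (LinearMap.range V'.toLinearMap ⊔
            (LinearMap.range E'.toLinearMap).topologicalClosure)ᗮ] ∧
    -- the "moreover" part
    ∀ (K₁ : Type u) [NormedAddCommGroup K₁] [InnerProductSpace ℂ K₁] [CompleteSpace K₁]
      (K₂ : Type u) [NormedAddCommGroup K₂] [InnerProductSpace ℂ K₂] [CompleteSpace K₂]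
      (ι₁ : H₁ →ₗᵢ[ℂ] K₁) (ι₂ : H₂ →ₗᵢ[ℂ] K₂)
      (V' : K₁ →L[ℂ] K₁) (E' : K₂ →L[ℂ] K₁) (N : K₂ →L[ℂ] K₂),
      ClassN (blockOp V' E' 0 N) →
      EntrywiseExtends ι₁ ι₂ (blockOp V E 0 S) (blockOp V' E' 0 N) →
      OpExtends ι₂ (modulus E) (modulus E') →
      IsMinimalNormalExtension ι₂ S N →
      -- (a)
      IsLift ι₂ S N (modulus E) (modulus E') ∧
      -- (b)
      (Function.Injective E ↔ Function.Injective E') ∧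
      (LeftInvertible E ↔ LeftInvertible E') ∧
      (Isometry E ↔ Isometry E') := by
  refine ⟨?_, ?_⟩
  · tfae_have 1 → 3 := by
      intro h
      obtain ⟨hV, hVE, hES, hS⟩ := isBrownianTypeOfClass_blockOp_iff.1 h
      refine ⟨hS, fun K₂ _ _ _ ι₂ N hm => ?_⟩
      obtain ⟨B, hB0, hB⟩ := hm.exists_nonneg_isOrbitLift (modulus_nonneg E) hES
      have hBs : IsSelfAdjoint B := IsSelfAdjoint.of_nonneg hB0
      have hD' := fun d hd => mem_orthogonal_range_sup_closure.1 (hD (x := d) hd)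
      obtain ⟨K₁, _, _, _, ι₁, V', E', h1, h2, h3, h4, h5, h6, h7⟩ :=
        exists_extension hm hB0 hB hV hVE hDclosed (fun x d hd => (hD' d hd).1 x)
          (fun x d hd => (hD' d hd).2 x)
      have : Nontrivial K₁ := ι₁.injective.nontrivial
      have : Nontrivial K₂ := ι₂.injective.nontrivial
      have hBN : Commute B N := by
        have := (hB.commute_star hm).star_star
        rw [hBs.star_eq, star_star] at this
        exact this.symm
      refine ⟨K₁, inferInstance, inferInstance, inferInstance, ι₁, V', E',
        isBrownianTypeOfClass_blockOp_iff.2 ⟨h1, h2, ?_, hm.1.1⟩,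
        entrywiseExtends_blockOp_iff.2 ⟨h3, h4, hm.1.2⟩, ?_, h6, hm.hilbertDim_eq, h7⟩
      · rw [h5]; exact hBN
      · rw [h5]; exact hB.opExtends
    tfae_have 3 → 2 := by
      rintro ⟨hS, h⟩
      obtain ⟨K₂, _, _, _, ι₂, N, hm⟩ := exists_isMinimalNormalExtension hS
      obtain ⟨K₁, _, _, _, ι₁, V', E', h1, h2, h3, -⟩ := h K₂ ι₂ N hm
      exact ⟨K₁, inferInstance, inferInstance, inferInstance, K₂, inferInstance, inferInstance,
        inferInstance, ι₁, ι₂, V', E', N, h1, h2, h3⟩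
    tfae_have 2 → 1 := by
      rintro ⟨K₁, _, _, _, K₂, _, _, _, ι₁, ι₂, V', E', N, h1, h2, h3⟩
      have := h1.nontrivial_fst
      have := h1.nontrivial_snd
      obtain ⟨hV, hVE, hEN, hN⟩ := isBrownianTypeOfClass_blockOp_iff.1 h1
      obtain ⟨eV, eE, eS⟩ := entrywiseExtends_blockOp_iff.1 h2
      refine isBrownianTypeOfClass_blockOp_iff.2 ⟨fun x => ?_, fun x y => ?_,
        h3.commute eS hEN, K₂, inferInstance, inferInstance, inferInstance, ι₂, N, hN, eS⟩
      · rw [← ι₁.norm_map, eV x, hV, ι₁.norm_map]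
      · rw [← ι₁.inner_map_map, eV x, eE y, hVE]
    tfae_finish
  · intro K₁ _ _ _ K₂ _ _ _ ι₁ ι₂ V' E' N h1 h2 h3 hm
    have := h1.nontrivial_fst
    have := h1.nontrivial_snd
    obtain ⟨-, -, hEN, hN⟩ := isBrownianTypeOfClass_blockOp_iff.1 h1
    obtain ⟨-, eE, eS⟩ := entrywiseExtends_blockOp_iff.1 h2
    have hE's := modulus_isSelfAdjoint E'
    have hc : Commute (star N) (modulus E') := by
      have := hEN.star_star
      rw [hE's.star_eq] at this
      exact this.symm
    have hlift := h3.isOrbitLift hc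
    have hES := h3.commute eS hEN
    refine ⟨hlift.isLift hm (modulus_isSelfAdjoint E) hE's hES,
      ⟨hlift.injective_of_injective hm, fun h x y hxy => ?_⟩,
      ⟨hlift.leftInvertible_of_leftInvertible hm hES, ?_⟩,
      ⟨hlift.isometry_of_isometry hm, fun h => ?_⟩⟩
    · apply ι₂.injective
      apply h
      rw [← eE, ← eE, hxy]
    · rintro ⟨L, hL⟩
      -- Compress `L`: on `E x` it returns `ι₂ x`, which `ι₂*` sends back to `x`.
      refine ⟨adjoint ι₂.toContinuousLinearMap ∘L L ∘L ι₁.toContinuousLinearMap, ?_⟩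
      ext x
      have h5 : L (E' (ι₂ x)) = ι₂ x := congrArg (fun T => T (ι₂ x)) hL
      change adjoint ι₂.toContinuousLinearMap (L (ι₁ (E x))) = x
      rw [eE, h5, adjoint_isometry_apply]
    · refine (AddMonoidHomClass.isometry_iff_norm E).2 fun x => ?_
      rw [← ι₁.norm_map, eE, (AddMonoidHomClass.isometry_iff_norm E').1 h, ι₂.norm_map]
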